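/- **Setting.** Let $F$ be a local field of characteristic $0$, $\psi:F\to\mathbb C^1$ a non-trivial continuous unitary character, and $(Z,\langle\,,\,\rangle)$ a finite-dimensional symplectic space over $F$ (for example $Z=V\otimes_E W$ for an $\epsilon$-hermitian space $V$ and a $(-\epsilon)$-hermitian space $W$). Let $Z\oplus(-Z)$ be $Z\oplus Z$ with the form $\langle (a,b),(c,d)\rangle=\langle a,c\rangle-\langle b,d\rangle$ (for $Z=V\otimes_E W$ this is $V\otimes_E(W\oplus -W)$), with diagonal Lagrangian $\Delta=\{(z,z)\}$ (that is, $V\otimes_E W^{\rm diag}$). For a Lagrangian $\ell$ in a symplectic space $S$ over $F$, consider half-densities on $S/\ell$ with values in the line bundle whose sections are the functions $f$ on $S$ with $f(\lambda+s)=\psi(\tfrac12\langle s,\lambda\rangle)f(s)$ for $\lambda\in\ell$. A splitting of $S\to S/\ell$ and a Haar measure on $S/\ell$ turn such half-densities into functions on $S/\ell$; let $\mathcal H_\ell^\infty$ be the space of those that become Schwartz–Bruhat functions (the smooth vectors of the model $\mathcal H_\ell$ of the oscillator representation of $\widetilde{\mathrm{Sp}}(S)$). The inner product is $\langle\varphi_1,\varphi_2\rangle=\int_{S/\ell}\varphi_1\overline{\varphi_2}$.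 For Lagrangians $\ell_1,\ell_2$ of $S$, let $\mu_{\ell_1,\ell_2}$ be the Haar measure on the symplectic space $(\ell_1+\ell_2)/(\ell_1\cap\ell_2)$ that is self-dual with respect to $\psi(\langle\,,\,\rangle)$. Its square root is a half-density on $\ell_1/(\ell_1\cap\ell_2)\oplus\ell_2/(\ell_1\cap\ell_2)$, and the canonical intertwiner from $\mathcal H_{\ell_1}$ to $\mathcal H_{\ell_2}$ is $$(\mathcal F_{\ell_1,\ell_2}\varphi)(y)=\int_{x\in \ell_2/(\ell_1\cap\ell_2)}\varphi(x+y)\,\psi\!\left(\tfrac12\langle x,y\rangle\right)\mu_{\ell_1,\ell_2}^{1/2}.$$ **Lemma.** Let $Y\subset Z$ be a Lagrangian, and let $\varphi_1,\varphi_2\in\mathcal H_Y^\infty$ be smooth vectors of the oscillator representation $\boldsymbol\omega$ of $\widetilde{\mathrm{Sp}}(Z)$, realized on $\mathcal H_Y$. Choose any complement $X$ of $Y$ in $Z$ and any Haar measure $dx$ on $Z/Y=Y^*$; they turn $\varphi_1,\varphi_2$ into functions $\Phi_1,\Phi_2$ on $Z/Y$. Let $\tilde\varphi$ be the half-density on $(Z\oplus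 Z)/(Y\oplus Y)$ that corresponds, through $X\oplus X$ and $dx\times dx$, to the function $(x,y)\mapsto\Phi_1(x)\overline{\Phi_2(y)}$: this is the image of $\varphi_1\otimes\overline{\varphi_2}$ under the canonical identification of $\boldsymbol\omega\hat\otimes\overline{\boldsymbol\omega}$ with the oscillator representation $\tilde{\boldsymbol\omega}$ of $Z\oplus(-Z)$, realized on $\mathcal H_{Y\oplus Y}$. Let $\Phi$ be the function on $(Z\oplus Z)/\Delta$ obtained from $\mathcal F_{Y\oplus Y,\Delta}(\tilde\varphi)\in\mathcal H_\Delta$ through the splitting whose image is the first copy $Z\oplus 0$ and the Haar measure that corresponds, under $Z\simeq (Z\oplus Z)/\Delta$, $z\mapsto[(z,0)]$, to the Haar measure $dz$ on $Z$ that is self-dual with respect to $\psi(\langle\,,\,\rangle)$; this is the canonical Schrödinger model of $\tilde{\boldsymbol\omega}$ on $(Z\oplus Z)/\Delta\simeq\Delta^*$. Then $\Phi$ is a Schwartz–Bruhat function, and $$\Phi(0)=\langle\varphi_1,\varphi_2\rangle_{\boldsymbol\omega}.$$ -/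

import Mathlib

open MeasureTheory Topology
open scoped NNReal SchwartzMap

namespace Oscillator

/-! ### Finite-dimensional spaces over a local field -/

section FiniteDimensional

variable {F : Type*} [NontriviallyNormedField F] [LocallyCompactSpace F]
variable {M : Type*} [AddCommGroup M] [Module F M] [TopologicalSpace M] [IsTopologicalAddGroup M]
  [ContinuousSMul F M] [T2Space M] [FiniteDimensional F M]

theorem completeSpace_field (F : Type*) [NontriviallyNormedField F] [LocallyCompactSpace F] :
    CompleteSpace F := by
  have : ProperSpace F := .of_nontriviallyNormedField_of_weaklyLocallyCompactSpace F
  infer_instance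

theorem exists_homeomorph (F : Type*) [NontriviallyNormedField F] [LocallyCompactSpace F]
    (M : Type*) [AddCommGroup M] [Module F M] [TopologicalSpace M] [IsTopologicalAddGroup M]
    [ContinuousSMul F M] [T2Space M] [FiniteDimensional F M] :
    Nonempty (M ≃ₜ (Fin (Module.finrank F M) → F)) := by
  have := completeSpace_field F
  exact ⟨(ContinuousLinearEquiv.ofFinrankEq (𝕜 := F) (E := M)
    (F := Fin (Module.finrank F M) → F) (by simp)).toHomeomorph⟩

theorem locallyCompactSpace_of_finiteDimensional (F : Type*) [NontriviallyNormedField F] [LocallyCompactSpace F]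
    (M : Type*) [AddCommGroup M] [Module F M] [TopologicalSpace M] [IsTopologicalAddGroup M]
    [ContinuousSMul F M] [T2Space M] [FiniteDimensional F M] :
    LocallyCompactSpace M := by
  obtain ⟨e⟩ := exists_homeomorph F M
  exact e.isClosedEmbedding.locallyCompactSpace

theorem polishSpace_of_finiteDimensional (F : Type*) [NontriviallyNormedField F] [LocallyCompactSpace F]
    (M : Type*) [AddCommGroup M] [Module F M] [TopologicalSpace M] [IsTopologicalAddGroup M]
    [ContinuousSMul F M] [T2Space M] [FiniteDimensional F M] :
    PolishSpace M := by
  have : ProperSpace F := .of_nontriviallyNormedField_of_weaklyLocallyCompactSpace F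
  obtain ⟨e⟩ := exists_homeomorph F M
  exact e.isClosedEmbedding.polishSpace

theorem borelSpace_prod (F : Type*) [NontriviallyNormedField F] [LocallyCompactSpace F]
    (M : Type*) [AddCommGroup M] [Module F M] [TopologicalSpace M] [IsTopologicalAddGroup M]
    [ContinuousSMul F M] [T2Space M] [FiniteDimensional F M]
    [MeasurableSpace M] [BorelSpace M] : BorelSpace (M × M) := by
  have := polishSpace_of_finiteDimensional F M
  infer_instance

instance t2Space_quotient (N : Submodule F M) : T2Space (M ⧸ N) := by
  have := completeSpace_field F
  have : IsClosed (N : Set M) := N.closed_of_finiteDimensional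
  infer_instance

instance borelSpace_quotient [MeasurableSpace M] [BorelSpace M] (N : Submodule F M) :
    BorelSpace (M ⧸ N) := by
  have := polishSpace_of_finiteDimensional F M
  have := polishSpace_of_finiteDimensional F (M ⧸ N)
  exact ⟨(N.continuous_mkQ).map_eq_borel N.mkQ_surjective⟩

instance locallyCompactSpace_quotient (N : Submodule F M) : LocallyCompactSpace (M ⧸ N) :=
  locallyCompactSpace_of_finiteDimensional F (M ⧸ N)

end FiniteDimensional

/-! ### Haar measures -/

/-- The Haar measures of a topological vector space. -/
def HaarMeasure (M : Type*) [AddCommGroup M] [TopologicalSpace M] [MeasurableSpace M] : Type _ :=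
  {μ : Measure M // μ.IsAddHaarMeasure}

namespace HaarMeasure

instance {M : Type*} [AddCommGroup M] [TopologicalSpace M] [MeasurableSpace M]
    (μ : HaarMeasure M) : (μ.1).IsAddHaarMeasure := μ.2

variable {F : Type*} [NontriviallyNormedField F] [LocallyCompactSpace F]
variable {M : Type*} [AddCommGroup M] [Module F M] [TopologicalSpace M] [IsTopologicalAddGroup M]
  [ContinuousSMul F M] [T2Space M] [FiniteDimensional F M] [MeasurableSpace M] [BorelSpace M]
variable {N : Type*} [AddCommGroup N] [Module F N] [TopologicalSpace N] [IsTopologicalAddGroup N]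
  [ContinuousSMul F N] [T2Space N] [FiniteDimensional F N] [MeasurableSpace N] [BorelSpace N]
variable {K : Type*} [AddCommGroup K] [Module F K] [TopologicalSpace K] [IsTopologicalAddGroup K]
  [ContinuousSMul F K] [T2Space K] [FiniteDimensional F K] [MeasurableSpace K] [BorelSpace K]

/-- Image of a Haar measure under a linear isomorphism. -/
noncomputable def map (e : M ≃ₗ[F] N) (μ : HaarMeasure M) : HaarMeasure N :=
  ⟨μ.1.map e, by
    have := completeSpace_field F
    exact AddEquiv.isAddHaarMeasure_map μ.1 (e : M ≃+ N)
      e.toContinuousLinearEquiv.continuous e.toContinuousLinearEquiv.symm.continuous⟩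

/-- Image of the product of two Haar measures under a linear isomorphism. -/
noncomputable def prodMap (e : (M × N) ≃ₗ[F] K) (μ : HaarMeasure M) (ν : HaarMeasure N) :
    HaarMeasure K :=
  ⟨(μ.1.prod ν.1).map e, by
    have := completeSpace_field F
    have := polishSpace_of_finiteDimensional F M
    have := polishSpace_of_finiteDimensional F N
    have := locallyCompactSpace_of_finiteDimensional F M
    have := locallyCompactSpace_of_finiteDimensional F N
    exact AddEquiv.isAddHaarMeasure_map (μ.1.prod ν.1) (e : (M × N) ≃+ K)
      e.toContinuousLinearEquiv.continuous e.toContinuousLinearEquiv.symm.continuous⟩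

/-- The positive number `c` with `μ = c • ν`. -/
noncomputable def ratio (μ ν : HaarMeasure M) : ℝ≥0 := μ.1.addHaarScalarFactor ν.1

theorem ratio_of_eq_smul (F : Type*) [NontriviallyNormedField F] [LocallyCompactSpace F]
    (M : Type*) [AddCommGroup M] [Module F M] [TopologicalSpace M] [IsTopologicalAddGroup M]
    [ContinuousSMul F M] [T2Space M] [FiniteDimensional F M]
    [MeasurableSpace M] [BorelSpace M] {μ μ' : HaarMeasure M} {c : ℝ≥0} (h : μ'.1 = c • μ.1)
    (ν : HaarMeasure M) : ratio μ' ν = c * ratio μ ν := by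
  have := locallyCompactSpace_of_finiteDimensional F M
  unfold ratio
  simp only [h]
  simp

theorem ratio_ne_zero (μ ν : HaarMeasure M) : ratio μ ν ≠ 0 :=
  (Measure.addHaarScalarFactor_pos_of_isAddHaarMeasure μ.1 ν.1).ne'

theorem sqrt_ratio_inv (F : Type*) [NontriviallyNormedField F] [LocallyCompactSpace F]
    {M : Type*} [AddCommGroup M] [Module F M] [TopologicalSpace M] [IsTopologicalAddGroup M]
    [ContinuousSMul F M] [T2Space M] [FiniteDimensional F M]
    [MeasurableSpace M] [BorelSpace M] {μ μ' : HaarMeasure M} {c : ℝ≥0} (h : μ'.1 = c • μ.1)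
    (ν : HaarMeasure M) :
    ((Real.sqrt (ratio μ ν) : ℂ))⁻¹ = (Real.sqrt c : ℂ) * (Real.sqrt (ratio μ' ν) : ℂ)⁻¹ := by
  have h1 := ratio_of_eq_smul F M h ν
  have hc : c ≠ 0 := by
    rintro rfl
    exact ratio_ne_zero μ' ν (by simpa using h1)
  have hc' : Real.sqrt c ≠ 0 := by positivity
  have hc'' : (Real.sqrt c : ℂ) ≠ 0 := by exact_mod_cast hc'
  rw [h1, NNReal.coe_mul, Real.sqrt_mul c.coe_nonneg, Complex.ofReal_mul, mul_inv, ← mul_assoc]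
  rw [mul_inv_cancel₀ hc'', one_mul]

/-- An auxiliary, arbitrary Haar measure. -/
noncomputable def some (F : Type*) [NontriviallyNormedField F] [LocallyCompactSpace F]
    (M : Type*) [AddCommGroup M] [Module F M] [TopologicalSpace M] [IsTopologicalAddGroup M]
    [ContinuousSMul F M] [T2Space M] [FiniteDimensional F M]
    [MeasurableSpace M] [BorelSpace M] : HaarMeasure M :=
  haveI := locallyCompactSpace_of_finiteDimensional F M
  ⟨Measure.addHaar, inferInstance⟩

end HaarMeasure

/-! ### Schwartz–Bruhat functions -/

/-- Schwartz–Bruhat functions on a finite-dimensional vector space `M` over a local field: locally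
constant with compact support if the field is non-Archimedean; the usual Schwartz functions on the
underlying real vector space if the field is Archimedean. (Over `ℝ` or `ℂ` the first alternative
only gives functions that also satisfy the second one; over a non-Archimedean field the second one
is only possible for `M = 0`.) -/
def IsSchwartzBruhat {M : Type*} [AddCommGroup M] [TopologicalSpace M] (f : M → ℂ) : Prop :=
  (IsLocallyConstant f ∧ HasCompactSupport f) ∨
    ∃ (n : ℕ) (e : M ≃ₜ+ EuclideanSpace ℝ (Fin n)) (g : 𝓢(EuclideanSpace ℝ (Fin n), ℂ)),
      ∀ x, f x = g (e x)

/-! ### Symplectic spaces -/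

section Symplectic

variable {F : Type*} [Field F] {Z : Type*} [AddCommGroup Z] [Module F Z]

/-- A non-degenerate alternating form. -/
structure IsSymplectic (B : LinearMap.BilinForm F Z) : Prop where
  isAlt : B.IsAlt
  nondegenerate : B.Nondegenerate

/-- A Lagrangian subspace: `ℓ^⊥ = ℓ`. -/
structure Lagrangian (B : LinearMap.BilinForm F Z) where
  space : Submodule F Z
  orthogonal_eq : B.orthogonal space = space

theorem Lagrangian.isotropic {B : LinearMap.BilinForm F Z} (ℓ : Lagrangian B) {x y : Z}
    (hx : x ∈ ℓ.space) (hy : y ∈ ℓ.space) : B x y = 0 := by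
  rw [← ℓ.orthogonal_eq] at hy
  exact hy x hx

/-- The form of `Z ⊕ (-Z)`: `⟨(a, b), (c, d)⟩ = ⟨a, c⟩ - ⟨b, d⟩`. -/
def doubleForm (B : LinearMap.BilinForm F Z) : LinearMap.BilinForm F (Z × Z) :=
  B.compl₁₂ (LinearMap.fst F Z Z) (LinearMap.fst F Z Z) -
    B.compl₁₂ (LinearMap.snd F Z Z) (LinearMap.snd F Z Z)

@[simp] theorem doubleForm_apply (B : LinearMap.BilinForm F Z) (p q : Z × Z) :
    doubleForm B p q = B p.1 q.1 - B p.2 q.2 := rfl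

theorem doubleForm_isAlt {B : LinearMap.BilinForm F Z} (hB : B.IsAlt) : (doubleForm B).IsAlt := by
  intro p
  simp [hB.self_eq_zero]

/-- `Y ⊕ Y ⊆ Z ⊕ (-Z)`. -/
def Lagrangian.double {B : LinearMap.BilinForm F Z} (Y : Lagrangian B) :
    Lagrangian (doubleForm B) where
  space := Y.space.prod Y.space
  orthogonal_eq := by
    ext p
    constructor
    · intro h
      refine ⟨?_, ?_⟩
      · rw [SetLike.mem_coe, ← Y.orthogonal_eq]
        intro n hn
        simpa using h (n, 0) ⟨hn, Y.space.zero_mem⟩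
      · rw [SetLike.mem_coe, ← Y.orthogonal_eq]
        intro n hn
        simpa using h (0, n) ⟨Y.space.zero_mem, hn⟩
    · rintro ⟨h1, h2⟩ n ⟨hn1, hn2⟩
      simp [Y.isotropic hn1 h1, Y.isotropic hn2 h2]

/-- The diagonal of `Z ⊕ (-Z)`. -/
def diagonal {B : LinearMap.BilinForm F Z} (hB : IsSymplectic B) :
    Lagrangian (doubleForm B) where
  space := LinearMap.eqLocus (LinearMap.fst F Z Z) (LinearMap.snd F Z Z)
  orthogonal_eq := by
    ext p
    constructor
    · intro h
      have h' : ∀ n, B n (p.1 - p.2) = 0 := by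
        intro n
        have := h (n, n) rfl
        simpa using this
      exact sub_eq_zero.mp (hB.nondegenerate.2 _ h')
    · intro (h : p.1 = p.2) n (hn : n.1 = n.2)
      simp [h, hn]

/-- The first copy of `Z` in `Z ⊕ (-Z)`. -/
def firstCopy (F Z : Type*) [Field F] [AddCommGroup Z] [Module F Z] : Submodule F (Z × Z) :=
  (⊤ : Submodule F Z).prod ⊥

theorem isCompl_firstCopy {B : LinearMap.BilinForm F Z} (hB : IsSymplectic B) :
    IsCompl (diagonal hB).space (firstCopy F Z) := by
  constructor
  · rw [Submodule.disjoint_def]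
    rintro ⟨a, b⟩ (h1 : a = b) ⟨-, h2⟩
    have h2 : b = 0 := h2
    simp [h1, h2]
  · rw [codisjoint_iff, eq_top_iff]
    rintro ⟨a, b⟩ -
    refine Submodule.mem_sup.2 ⟨(b, b), rfl, (a - b, 0), ⟨trivial, rfl⟩, by simp⟩

/-- The identification `Z → (Z ⊕ (-Z)) / diagonal` through the first copy of `Z`. -/
noncomputable def firstCopyEquiv {B : LinearMap.BilinForm F Z} (hB : IsSymplectic B) :
    Z ≃ₗ[F] ((Z × Z) ⧸ (diagonal hB).space) :=
  LinearEquiv.ofBijective ((diagonal hB).space.mkQ ∘ₗ LinearMap.inl F Z Z) <| by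
    constructor
    · rw [← LinearMap.ker_eq_bot, LinearMap.ker_eq_bot']
      intro z hz
      exact (Submodule.Quotient.mk_eq_zero _).1 hz
    · intro q
      obtain ⟨⟨a, b⟩, rfl⟩ := Submodule.mkQ_surjective _ q
      refine ⟨a - b, (Submodule.Quotient.eq _).2 ?_⟩
      change a - b - a = 0 - b
      abel

/-- A representative of a class in a quotient. -/
noncomputable def rep {N : Submodule F Z} (q : Z ⧸ N) : Z :=
  Function.surjInv N.mkQ_surjective q

theorem mk_rep {N : Submodule F Z} (q : Z ⧸ N) : (Submodule.Quotient.mk (rep q) : Z ⧸ N) = q :=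
  Function.surjInv_eq N.mkQ_surjective q

end Symplectic

/-! ### The canonical Schrödinger models -/

section Models

variable {F : Type*} [NontriviallyNormedField F] [LocallyCompactSpace F]
variable {Z : Type*} [AddCommGroup Z] [Module F Z] [TopologicalSpace Z] [IsTopologicalAddGroup Z]
  [ContinuousSMul F Z] [T2Space Z] [FiniteDimensional F Z] [MeasurableSpace Z] [BorelSpace Z]

/-- `μ` is self-dual for the symplectic form `B` and the character `ψ`: the Fourier transform
`f ↦ (y ↦ ∫ f(x) ψ(⟨x, y⟩) dμ(x))` is its own inverse. -/
def IsSelfDual {F Z : Type*} [NontriviallyNormedField F] [AddCommGroup Z] [Module F Z]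
    [TopologicalSpace Z] [MeasurableSpace Z] (ψ : AddChar F Circle)
    (B : LinearMap.BilinForm F Z) (μ : HaarMeasure Z) : Prop :=
  ∀ f : Z → ℂ, IsSchwartzBruhat f →
    ∀ z, ∫ y, (∫ x, f x * (ψ (B x y) : ℂ) ∂μ.1) * (ψ (B y z) : ℂ) ∂μ.1 = f z

/-- Half-densities on `Z / ℓ` valued in the line bundle whose sections are the functions `f` on `Z`
with `f (λ + z) = ψ (⟨z, λ⟩ / 2) f z` for `λ ∈ ℓ`. Such a half-density `φ` is encoded by all its
quotients `φ / μ^{1/2}`, where `μ` runs over the Haar measures of `Z / ℓ`. (No integrability is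
built in; the smooth vectors, which lie in `L²`, are singled out by `HalfDensity.IsSmooth`.) -/
structure HalfDensity {F Z : Type*} [NontriviallyNormedField F] [AddCommGroup Z] [Module F Z]
    [TopologicalSpace Z] [MeasurableSpace Z] (ψ : AddChar F Circle) (B : LinearMap.BilinForm F Z)
    (ℓ : Submodule F Z) where
  coeff : HaarMeasure (Z ⧸ ℓ) → Z → ℂ
  coeff_smul : ∀ (c : ℝ≥0) (μ μ' : HaarMeasure (Z ⧸ ℓ)), μ'.1 = c • μ.1 →
    ∀ z, coeff μ z = (Real.sqrt c : ℂ) * coeff μ' z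
  coeff_add : ∀ μ, ∀ l ∈ ℓ, ∀ z, coeff μ (l + z) = (ψ (B z l / 2) : ℂ) * coeff μ z

variable {ψ : AddChar F Circle} {B : LinearMap.BilinForm F Z}

/-- The hermitian pairing of half-densities, `⟨φ₁, φ₂⟩ = ∫_{Z/ℓ} φ₁ φ̄₂`, linear in `φ₁`. The
Haar measure that is used to write the density `φ₁ φ̄₂` as a function times a measure plays no
role. -/
noncomputable def HalfDensity.inner {ℓ : Submodule F Z} (φ₁ φ₂ : HalfDensity ψ B ℓ) : ℂ :=
  ∫ q, φ₁.coeff (HaarMeasure.some F (Z ⧸ ℓ)) (rep q) *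
    star (φ₂.coeff (HaarMeasure.some F (Z ⧸ ℓ)) (rep q)) ∂(HaarMeasure.some F (Z ⧸ ℓ)).1

/-- The splitting `Z / ℓ → Z` with image a complement `X` of `ℓ`. -/
noncomputable def splitting {ℓ X : Submodule F Z} (h : IsCompl ℓ X) (q : Z ⧸ ℓ) : Z :=
  (Submodule.quotientEquivOfIsCompl ℓ X h q : Z)

theorem mk_splitting {ℓ X : Submodule F Z} (h : IsCompl ℓ X) (q : Z ⧸ ℓ) :
    (Submodule.Quotient.mk (splitting h q) : Z ⧸ ℓ) = q := by
  have := (Submodule.quotientEquivOfIsCompl ℓ X h).symm_apply_apply q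
  rwa [Submodule.quotientEquivOfIsCompl_symm_apply] at this

/-- A splitting of `Z → Z / ℓ` and a Haar measure on `Z / ℓ` turn half-densities into functions on
`Z / ℓ`. -/
noncomputable def toFunction {ℓ X : Submodule F Z} (h : IsCompl ℓ X) (μ : HaarMeasure (Z ⧸ ℓ))
    (φ : HalfDensity ψ B ℓ) : Z ⧸ ℓ → ℂ :=
  fun q => φ.coeff μ (splitting h q)

/-- The inverse of `toFunction`: the half-density attached to a function on `Z / ℓ`. -/
noncomputable def ofFunction (ψ : AddChar F Circle) (hB : B.IsAlt) (ℓ : Lagrangian B)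
    {X : Submodule F Z} (h : IsCompl ℓ.space X) (μ : HaarMeasure (Z ⧸ ℓ.space))
    (Φ : Z ⧸ ℓ.space → ℂ) : HalfDensity ψ B ℓ.space where
  coeff μ' z := ((Real.sqrt (HaarMeasure.ratio μ' μ))⁻¹ : ℂ) *
    ((ψ (B (splitting h (Submodule.Quotient.mk z)) z / 2) : ℂ) * Φ (Submodule.Quotient.mk z))
  coeff_smul c μ₁ μ₂ hμ z := by
    rw [HaarMeasure.sqrt_ratio_inv F hμ μ]
    ring
  coeff_add μ' l hl z := by
    have h0 : (Submodule.Quotient.mk (l + z) : Z ⧸ ℓ.space) = Submodule.Quotient.mk z := by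
      rw [Submodule.Quotient.eq]
      simpa using hl
    rw [h0]
    set s := splitting h (Submodule.Quotient.mk z : Z ⧸ ℓ.space) with hs
    have h1 : z - s ∈ ℓ.space := by
      rw [← Submodule.Quotient.eq]
      exact (mk_splitting h _).symm
    have h2 : B s l = B z l := by
      have := ℓ.isotropic h1 hl
      rw [map_sub, LinearMap.sub_apply, sub_eq_zero] at this
      exact this.symm
    rw [map_add, add_div, AddChar.map_add_eq_mul, h2, Circle.coe_mul]
    ring

theorem toFunction_ofFunction (hB : B.IsAlt) (ℓ : Lagrangian B)
    {X : Submodule F Z} (h : IsCompl ℓ.space X) (μ : HaarMeasure (Z ⧸ ℓ.space))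
    (Φ : Z ⧸ ℓ.space → ℂ) : toFunction h μ (ofFunction ψ hB ℓ h μ Φ) = Φ := by
  funext q
  have h1 : HaarMeasure.ratio μ μ = 1 := Measure.addHaarScalarFactor_self μ.1
  simp [toFunction, ofFunction, h1, mk_splitting, hB.self_eq_zero]

/-- The smooth vectors of the model attached to `ℓ`: the half-densities that correspond to
Schwartz–Bruhat functions (this does not depend on the splitting and on the Haar measure). -/
def HalfDensity.IsSmooth {ℓ : Submodule F Z} (φ : HalfDensity ψ B ℓ) : Prop :=
  ∃ (X : Submodule F Z) (h : IsCompl ℓ X) (μ : HaarMeasure (Z ⧸ ℓ)),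
    IsSchwartzBruhat (toFunction h μ φ)

end Models

/-! ### The canonical intertwining operators -/

section Intertwiner

variable {F : Type*} [Field F] {Z : Type*} [AddCommGroup Z] [Module F Z]

/-- `ℓ' / (ℓ ∩ ℓ')`. -/
abbrev RelQuot (ℓ ℓ' : Submodule F Z) : Type _ := ↥ℓ' ⧸ ℓ.submoduleOf ℓ'

/-- The inclusion `ℓ' / (ℓ ∩ ℓ') → Z / ℓ`. -/
def relIncl (ℓ ℓ' : Submodule F Z) : RelQuot ℓ ℓ' →ₗ[F] Z ⧸ ℓ :=
  (ℓ.submoduleOf ℓ').mapQ ℓ ℓ'.subtype le_rfl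

/-- A linear splitting of the projection `Z / ℓ → Z / P`, for `ℓ ⊆ P`. -/
noncomputable def relSplit {ℓ P : Submodule F Z} (h : ℓ ≤ P) : Z ⧸ P →ₗ[F] Z ⧸ ℓ :=
  ((Submodule.factor h).exists_rightInverse_of_surjective
    (LinearMap.range_eq_top.2 (Submodule.factor_surjective h))).choose

theorem factor_relSplit {ℓ P : Submodule F Z} (h : ℓ ≤ P) (c : Z ⧸ P) :
    Submodule.factor h (relSplit h c) = c :=
  LinearMap.congr_fun ((Submodule.factor h).exists_rightInverse_of_surjective
    (LinearMap.range_eq_top.2 (Submodule.factor_surjective h))).choose_spec c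

/-- If `P = ℓ + ℓ'`, the exact sequence `0 → ℓ'/(ℓ ∩ ℓ') → Z/ℓ → Z/P → 0`, split. -/
noncomputable def relEquiv (ℓ ℓ' : Submodule F Z) {P : Submodule F Z} (hP : ℓ ⊔ ℓ' = P) :
    (RelQuot ℓ ℓ' × (Z ⧸ P)) ≃ₗ[F] Z ⧸ ℓ :=
  LinearEquiv.ofBijective
    ((relIncl ℓ ℓ').coprod (relSplit (le_sup_left.trans hP.le : ℓ ≤ P))) <| by
    have hle : ℓ ≤ P := le_sup_left.trans hP.le
    have hle' : ℓ' ≤ P := le_sup_right.trans hP.le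
    have hf : ∀ a : RelQuot ℓ ℓ', Submodule.factor hle (relIncl ℓ ℓ' a) = 0 := by
      intro a
      obtain ⟨a, rfl⟩ := Submodule.mkQ_surjective _ a
      exact (Submodule.Quotient.mk_eq_zero _).2 (hle' a.2)
    constructor
    · rw [← LinearMap.ker_eq_bot, LinearMap.ker_eq_bot']
      rintro ⟨a, c⟩ h
      rw [LinearMap.coprod_apply] at h
      have hc : c = 0 := by
        have := congrArg (Submodule.factor hle) h
        rwa [map_add, hf, factor_relSplit, zero_add, map_zero] at this
      subst hc
      rw [map_zero, add_zero] at h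
      obtain ⟨a, rfl⟩ := Submodule.mkQ_surjective _ a
      have h' : (a : Z) ∈ ℓ := (Submodule.Quotient.mk_eq_zero _).1 h
      have : (ℓ.submoduleOf ℓ').mkQ a = 0 := (Submodule.Quotient.mk_eq_zero _).2 h'
      rw [this]
      rfl
    · intro q
      have hq : Submodule.factor hle (q - relSplit hle (Submodule.factor hle q)) = 0 := by
        rw [map_sub, factor_relSplit, sub_self]
      obtain ⟨z, hz⟩ := Submodule.mkQ_surjective _ (q - relSplit hle (Submodule.factor hle q))
      rw [← hz] at hq
      have hzP : z ∈ P := (Submodule.Quotient.mk_eq_zero _).1 hq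
      rw [← hP] at hzP
      obtain ⟨l, hl, l', hl', rfl⟩ := Submodule.mem_sup.1 hzP
      refine ⟨((ℓ.submoduleOf ℓ').mkQ ⟨l', hl'⟩, Submodule.factor hle q), ?_⟩
      rw [LinearMap.coprod_apply]
      have : relIncl ℓ ℓ' ((ℓ.submoduleOf ℓ').mkQ ⟨l', hl'⟩) = ℓ.mkQ (l + l') := by
        refine (Submodule.Quotient.eq _).2 ?_
        simpa using hl
      rw [this, hz]
      abel

/-- `(ℓ₁ + ℓ₂) / (ℓ₁ ∩ ℓ₂)`. -/
abbrev SubQuot (ℓ₁ ℓ₂ : Submodule F Z) : Type _ :=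
  ↥(ℓ₁ ⊔ ℓ₂) ⧸ (ℓ₁ ⊓ ℓ₂).submoduleOf (ℓ₁ ⊔ ℓ₂)

/-- `ℓ₁ / (ℓ₁ ∩ ℓ₂) ⊕ ℓ₂ / (ℓ₁ ∩ ℓ₂) = (ℓ₁ + ℓ₂) / (ℓ₁ ∩ ℓ₂)`. -/
noncomputable def subQuotEquiv (ℓ₁ ℓ₂ : Submodule F Z) :
    (RelQuot ℓ₂ ℓ₁ × RelQuot ℓ₁ ℓ₂) ≃ₗ[F] SubQuot ℓ₁ ℓ₂ :=
  LinearEquiv.ofBijective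
    (LinearMap.coprod
      ((ℓ₂.submoduleOf ℓ₁).mapQ ((ℓ₁ ⊓ ℓ₂).submoduleOf (ℓ₁ ⊔ ℓ₂))
        (Submodule.inclusion le_sup_left) (fun x hx => ⟨x.2, hx⟩))
      ((ℓ₁.submoduleOf ℓ₂).mapQ ((ℓ₁ ⊓ ℓ₂).submoduleOf (ℓ₁ ⊔ ℓ₂))
        (Submodule.inclusion le_sup_right) (fun x hx => ⟨hx, x.2⟩))) <| by
    constructor
    · rw [← LinearMap.ker_eq_bot, LinearMap.ker_eq_bot']
      rintro ⟨a, b⟩ h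
      obtain ⟨a, rfl⟩ := Submodule.mkQ_surjective _ a
      obtain ⟨b, rfl⟩ := Submodule.mkQ_surjective _ b
      have h' : (a : Z) + b ∈ ℓ₁ ⊓ ℓ₂ := (Submodule.Quotient.mk_eq_zero
        ((ℓ₁ ⊓ ℓ₂).submoduleOf (ℓ₁ ⊔ ℓ₂)) (x := Submodule.inclusion le_sup_left a +
          Submodule.inclusion le_sup_right b)).1 h
      have ha : (a : Z) ∈ ℓ₂ := (Submodule.add_mem_iff_left _ b.2).1 h'.2
      have hb : (b : Z) ∈ ℓ₁ := (Submodule.add_mem_iff_right _ a.2).1 h'.1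
      have ha' : (ℓ₂.submoduleOf ℓ₁).mkQ a = 0 := (Submodule.Quotient.mk_eq_zero _).2 ha
      have hb' : (ℓ₁.submoduleOf ℓ₂).mkQ b = 0 := (Submodule.Quotient.mk_eq_zero _).2 hb
      rw [ha', hb']
      rfl
    · intro q
      obtain ⟨⟨z, hz⟩, rfl⟩ := Submodule.mkQ_surjective _ q
      obtain ⟨x, hx, y, hy, rfl⟩ := Submodule.mem_sup.1 hz
      exact ⟨((ℓ₂.submoduleOf ℓ₁).mkQ ⟨x, hx⟩, (ℓ₁.submoduleOf ℓ₂).mkQ ⟨y, hy⟩), rfl⟩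

theorem apply_eq_zero_of_inf_sup {B : LinearMap.BilinForm F Z}
    (ℓ₁ ℓ₂ : Lagrangian B) {x y : Z} (hx : x ∈ ℓ₁.space ⊓ ℓ₂.space)
    (hy : y ∈ ℓ₁.space ⊔ ℓ₂.space) : B x y = 0 ∧ B y x = 0 := by
  obtain ⟨a, ha, b, hb, rfl⟩ := Submodule.mem_sup.1 hy
  constructor
  · rw [map_add, ℓ₁.isotropic hx.1 ha, ℓ₂.isotropic hx.2 hb, add_zero]
  · rw [map_add, LinearMap.add_apply, ℓ₁.isotropic ha hx.1, ℓ₂.isotropic hb hx.2, add_zero]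

/-- The symplectic form that `B` induces on `(ℓ₁ + ℓ₂) / (ℓ₁ ∩ ℓ₂)`. -/
def subQuotForm {B : LinearMap.BilinForm F Z} (ℓ₁ ℓ₂ : Lagrangian B) :
    LinearMap.BilinForm F (SubQuot ℓ₁.space ℓ₂.space) :=
  Submodule.liftQ _
    (LinearMap.flip (Submodule.liftQ _
      (B.compl₁₂ (ℓ₁.space ⊔ ℓ₂.space).subtype (ℓ₁.space ⊔ ℓ₂.space).subtype).flip
      (fun y hy => by
        ext x
        exact (apply_eq_zero_of_inf_sup ℓ₁ ℓ₂ hy x.2).2)))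
    (fun x hx => by
      ext y
      exact (apply_eq_zero_of_inf_sup ℓ₁ ℓ₂ hx y.2).1)

theorem subQuotForm_mk {B : LinearMap.BilinForm F Z} (ℓ₁ ℓ₂ : Lagrangian B)
    (x y : ↥(ℓ₁.space ⊔ ℓ₂.space)) :
    subQuotForm ℓ₁ ℓ₂ (Submodule.Quotient.mk x) (Submodule.Quotient.mk y) = B x y := rfl

end Intertwiner

section Intertwiner

variable {F : Type*} [NontriviallyNormedField F] [LocallyCompactSpace F]
variable {Z : Type*} [AddCommGroup Z] [Module F Z] [TopologicalSpace Z] [IsTopologicalAddGroup Z]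
  [ContinuousSMul F Z] [T2Space Z] [FiniteDimensional F Z] [MeasurableSpace Z] [BorelSpace Z]

/-- The Haar measure on `Z / ℓ` given by Haar measures on `ℓ' / (ℓ ∩ ℓ')` and `Z / P`, where
`P = ℓ + ℓ'`. By translation invariance it does not depend on the splitting inside `relEquiv`. -/
noncomputable def extMeasure (ℓ ℓ' : Submodule F Z) {P : Submodule F Z} (hP : ℓ ⊔ ℓ' = P)
    (ν : HaarMeasure (RelQuot ℓ ℓ')) (ρ : HaarMeasure (Z ⧸ P)) : HaarMeasure (Z ⧸ ℓ) :=
  HaarMeasure.prodMap (relEquiv ℓ ℓ' hP) ν ρ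

variable {ψ : AddChar F Circle} {B : LinearMap.BilinForm F Z}

theorem integrand_invariant (hB : B.IsAlt) (ℓ₁ ℓ₂ : Lagrangian B)
    (φ : HalfDensity ψ B ℓ₁.space) (μ : HaarMeasure (Z ⧸ ℓ₁.space)) {x x' : Z}
    (hx : x ∈ ℓ₂.space) (hx' : x' ∈ ℓ₂.space) (h : x' - x ∈ ℓ₁.space) (y : Z) :
    φ.coeff μ (x' + y) * (ψ (B x' y / 2) : ℂ) = φ.coeff μ (x + y) * (ψ (B x y / 2) : ℂ) := by
  obtain ⟨t, rfl⟩ : ∃ t, x' = t + x := ⟨x' - x, by abel⟩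
  have ht : t ∈ ℓ₁.space := by simpa using h
  have ht2 : t ∈ ℓ₂.space := (Submodule.add_mem_iff_left _ hx).1 hx'
  have h1 : B (x + y) t = - B t y := by
    rw [map_add, LinearMap.add_apply, ℓ₂.isotropic hx ht2, zero_add, hB.neg_eq]
  rw [add_assoc, φ.coeff_add μ t ht, h1, map_add, LinearMap.add_apply, add_div,
    AddChar.map_add_eq_mul, Circle.coe_mul, neg_div, AddChar.map_neg_eq_inv, Circle.coe_inv]
  have : (ψ (B t y / 2) : ℂ) ≠ 0 := Circle.coe_ne_zero _
  field_simp

/-- The canonical intertwiner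
`(F φ)(y) = ∫_{x ∈ ℓ₂/(ℓ₁ ∩ ℓ₂)} φ(x + y) ψ(⟨x, y⟩ / 2) μ₁₂^{1/2}`
from half-densities on `Z / ℓ₁` to half-densities on `Z / ℓ₂`, where `μ₁₂` is a Haar measure on
`(ℓ₁ + ℓ₂) / (ℓ₁ ∩ ℓ₂)`.

To read the right-hand side, take Haar measures `ν₁`, `ν₂`, `ρ` on `ℓ₁ / (ℓ₁ ∩ ℓ₂)`,
`ℓ₂ / (ℓ₁ ∩ ℓ₂)`, `Z / (ℓ₁ + ℓ₂)` and write `μ₁₂ = c ν₁ ν₂`. A half-density on `Z / ℓ₁` is a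
function times `(ν₂ ρ)^{1/2}`, and `(ν₂ ρ)^{1/2} μ₁₂^{1/2} = c^{1/2} ν₂ (ν₁ ρ)^{1/2}`, where
`ν₁ ρ` is a Haar measure on `Z / ℓ₂`. The result does not depend on `ν₁`, `ν₂`, `ρ`. -/
noncomputable def intertwiner (hB : B.IsAlt) (ℓ₁ ℓ₂ : Lagrangian B)
    (μ₁₂ : HaarMeasure (SubQuot ℓ₁.space ℓ₂.space)) (φ : HalfDensity ψ B ℓ₁.space) :
    HalfDensity ψ B ℓ₂.space :=
  let ν₁ : HaarMeasure (RelQuot ℓ₂.space ℓ₁.space) := HaarMeasure.some F _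
  let ν₂ : HaarMeasure (RelQuot ℓ₁.space ℓ₂.space) := HaarMeasure.some F _
  let ρ : HaarMeasure (Z ⧸ (ℓ₁.space ⊔ ℓ₂.space)) := HaarMeasure.some F _
  let c : ℝ≥0 := HaarMeasure.ratio μ₁₂
    (HaarMeasure.prodMap (subQuotEquiv ℓ₁.space ℓ₂.space) ν₁ ν₂)
  let μ₁ : HaarMeasure (Z ⧸ ℓ₁.space) := extMeasure ℓ₁.space ℓ₂.space rfl ν₂ ρ
  let μ₂ : HaarMeasure (Z ⧸ ℓ₂.space) := extMeasure ℓ₂.space ℓ₁.space (sup_comm _ _) ν₁ ρ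
  { coeff := fun μ y => ((Real.sqrt (HaarMeasure.ratio μ μ₂))⁻¹ : ℂ) * ((Real.sqrt c : ℂ) *
      ∫ q, φ.coeff μ₁ ((rep q : ℓ₂.space) + y) * (ψ (B (rep q : ℓ₂.space) y / 2) : ℂ) ∂ν₂.1)
    coeff_smul := by
      intro d μ μ' hμ z
      rw [HaarMeasure.sqrt_ratio_inv F hμ μ₂]
      ring
    coeff_add := by
      intro μ l hl z
      have key : ∫ q, φ.coeff μ₁ ((rep q : ℓ₂.space) + (l + z)) *
            (ψ (B (rep q : ℓ₂.space) (l + z) / 2) : ℂ) ∂ν₂.1 =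
          (ψ (B z l / 2) : ℂ) * ∫ q, φ.coeff μ₁ ((rep q : ℓ₂.space) + z) *
            (ψ (B (rep q : ℓ₂.space) z / 2) : ℂ) ∂ν₂.1 := by
        rw [← integral_const_mul, ← integral_add_right_eq_self (μ := ν₂.1)
          (fun q => (ψ (B z l / 2) : ℂ) * (φ.coeff μ₁ ((rep q : ℓ₂.space) + z) *
            (ψ (B (rep q : ℓ₂.space) z / 2) : ℂ)))
          (Submodule.Quotient.mk ⟨l, hl⟩ : RelQuot ℓ₁.space ℓ₂.space)]
        refine integral_congr_ae (Filter.Eventually.of_forall fun q => ?_)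
        have h2 : ((rep (q + Submodule.Quotient.mk ⟨l, hl⟩) : ℓ₂.space) : Z) -
            ((rep q : ℓ₂.space) + l) ∈ ℓ₁.space := by
          have : (Submodule.Quotient.mk (rep (q + Submodule.Quotient.mk ⟨l, hl⟩)) :
              RelQuot ℓ₁.space ℓ₂.space) = Submodule.Quotient.mk (rep q + ⟨l, hl⟩) := by
            rw [mk_rep, Submodule.Quotient.mk_add, mk_rep]
          exact (Submodule.Quotient.eq (ℓ₁.space.submoduleOf ℓ₂.space)).1 this
        simp only
        rw [integrand_invariant hB ℓ₁ ℓ₂ φ μ₁ (ℓ₂.space.add_mem (rep q).2 hl)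
          (Subtype.prop _) h2 z]
        have h3 : B ((rep q : ℓ₂.space) : Z) (l + z) = B ((rep q : ℓ₂.space) : Z) z := by
          rw [map_add, ℓ₂.isotropic (rep q).2 hl, zero_add]
        have h4 : B (((rep q : ℓ₂.space) : Z) + l) z = B ((rep q : ℓ₂.space) : Z) z - B z l := by
          rw [map_add, LinearMap.add_apply, ← hB.neg_eq z l, sub_eq_add_neg]
        rw [h3, h4, sub_div, sub_eq_add_neg, AddChar.map_add_eq_mul, AddChar.map_neg_eq_inv,
          Circle.coe_mul, Circle.coe_inv, add_assoc]
        have : (ψ (B z l / 2) : ℂ) ≠ 0 := Circle.coe_ne_zero _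
        field_simp
      rw [key]
      ring }

/-! ### Doubling -/

/-- `Z/Y ⊕ Z/Y = (Z ⊕ Z) / (Y ⊕ Y)`. -/
noncomputable def quotProdEquiv (Y : Lagrangian B) :
    ((Z ⧸ Y.space) × (Z ⧸ Y.space)) ≃ₗ[F] ((Z × Z) ⧸ Y.double.space) :=
  LinearEquiv.ofBijective
    (LinearMap.coprod
      (Y.space.mapQ Y.double.space (LinearMap.inl F Z Z) (fun _ hx => ⟨hx, Y.space.zero_mem⟩))
      (Y.space.mapQ Y.double.space (LinearMap.inr F Z Z) (fun _ hx => ⟨Y.space.zero_mem, hx⟩))) <| by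
    have h : ∀ a b : Z, LinearMap.coprod
        (Y.space.mapQ Y.double.space (LinearMap.inl F Z Z) (fun _ hx => ⟨hx, Y.space.zero_mem⟩))
        (Y.space.mapQ Y.double.space (LinearMap.inr F Z Z) (fun _ hx => ⟨Y.space.zero_mem, hx⟩))
        (Y.space.mkQ a, Y.space.mkQ b) = Y.double.space.mkQ (a, b) := by
      intro a b
      rw [LinearMap.coprod_apply]
      change Y.double.space.mkQ (a, 0) + Y.double.space.mkQ (0, b) = _
      rw [← map_add]
      simp
    constructor
    · rw [← LinearMap.ker_eq_bot, LinearMap.ker_eq_bot']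
      rintro ⟨a, b⟩ hab
      obtain ⟨a, rfl⟩ := Submodule.mkQ_surjective _ a
      obtain ⟨b, rfl⟩ := Submodule.mkQ_surjective _ b
      rw [h] at hab
      obtain ⟨h1, h2⟩ := (Submodule.Quotient.mk_eq_zero _).1 hab
      exact Prod.ext ((Submodule.Quotient.mk_eq_zero _).2 h1)
        ((Submodule.Quotient.mk_eq_zero _).2 h2)
    · intro q
      obtain ⟨⟨a, b⟩, rfl⟩ := Submodule.mkQ_surjective _ q
      exact ⟨(Y.space.mkQ a, Y.space.mkQ b), h a b⟩

theorem isCompl_double (Y : Lagrangian B) {X : Submodule F Z} (h : IsCompl Y.space X) :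
    IsCompl Y.double.space (X.prod X) := by
  change IsCompl (Y.space.prod Y.space) (X.prod X)
  constructor
  · rw [disjoint_iff, Submodule.prod_inf_prod, h.inf_eq_bot, Submodule.prod_bot]
  · rw [codisjoint_iff, Submodule.prod_sup_prod, h.sup_eq_top, Submodule.prod_top]

/-- The element of the model of `Z ⊕ (-Z)` attached to `Y ⊕ Y` that corresponds to `φ₁ ⊗ φ̄₂`.
A complement `X` of `Y` and a Haar measure `dx` on `Z / Y` turn `φ₁`, `φ₂` into functions
`Φ₁`, `Φ₂` on `Z / Y`; the complement `X ⊕ X` of `Y ⊕ Y` and the Haar measure `dx × dx` turn the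
function `(x, y) ↦ Φ₁(x) Φ̄₂(y)` into a half-density on `(Z ⊕ Z) / (Y ⊕ Y)`. -/
noncomputable def doubling (hB : B.IsAlt) (Y : Lagrangian B) {X : Submodule F Z}
    (h : IsCompl Y.space X) (dx : HaarMeasure (Z ⧸ Y.space)) (φ₁ φ₂ : HalfDensity ψ B Y.space) :
    HalfDensity ψ (doubleForm B) Y.double.space :=
  haveI := borelSpace_prod F Z
  ofFunction ψ (doubleForm_isAlt hB) Y.double (isCompl_double Y h)
    (HaarMeasure.prodMap (quotProdEquiv Y) dx dx)
    (fun q => toFunction h dx φ₁ ((quotProdEquiv Y).symm q).1 *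
      star (toFunction h dx φ₂ ((quotProdEquiv Y).symm q).2))

/-- The canonical intertwiner of `Z ⊕ (-Z)` from the model attached to `Y ⊕ Y` to the model attached
to the diagonal. -/
noncomputable def toDiagonal (hB : IsSymplectic B) (Y : Lagrangian B)
    (μ : HaarMeasure (SubQuot Y.double.space (diagonal hB).space))
    (φ : HalfDensity ψ (doubleForm B) Y.double.space) :
    HalfDensity ψ (doubleForm B) (diagonal hB).space :=
  haveI := borelSpace_prod F Z
  intertwiner (doubleForm_isAlt hB.isAlt) Y.double (diagonal hB) μ φ

/-- The canonical Schrödinger model of `Z ⊕ (-Z)` on the quotient by the diagonal: the splitting is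
the first copy of `Z`, and the Haar measure comes from a Haar measure `dz` on `Z`. -/
noncomputable def diagonalModel (hB : IsSymplectic B) (dz : HaarMeasure Z)
    (φ : HalfDensity ψ (doubleForm B) (diagonal hB).space) :
    (Z × Z) ⧸ (diagonal hB).space → ℂ :=
  haveI := borelSpace_prod F Z
  toFunction (isCompl_firstCopy hB) (HaarMeasure.map (firstCopyEquiv hB) dz) φ

end Intertwiner

end Oscillator

set_option linter.unusedSectionVars false

/-! The computation behind the theorem is short. The half-density attached to `φ₁ ⊗ φ̄₂` has
coefficient `φ₁(a) φ̄₂(b)` up to a constant, whatever complement is used to write it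
(`doubling_coeff`). Since `Δ / ((Y ⊕ Y) ∩ Δ)` is `Z / Y`, the intertwiner evaluated at `(z, 0)` is
`K ∫ φ₁(x + z) φ̄₂(x) ψ(⟨x, z⟩ / 2) dx` over `x ∈ Z / Y`, with `K` depending only on Haar measures
(`exists_diagonalModel_eq_integral`). At `z = 0` this is `K ⟨φ₁, φ₂⟩`.

That `K = 1` is a comparison of measures (`intertwiner_constant_eq_one`). An isotropic complement of
`Y` identifies `Z` isometrically with `(Y ⊕ Y + Δ) / ((Y ⊕ Y) ∩ Δ)`, through `Y ⊕ Z / Y`. Self-dual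
measures are unique (`IsSelfDual.unique`), so `dz` and `μ` correspond to each other, and the
auxiliary Haar measures inside the intertwiner cancel.

For the Schwartz–Bruhat property, write `z = y + w` with `y ∈ Y` and `w` in the isotropic
complement, and shift `x` by `-w / 2`. The integral becomes `∫ Φ₁(x + w/2) Φ̄₂(x - w/2) ψ(⟨x, y⟩)
dx`, the Wigner transform (`integral_translate_eq_partialFourier`): a linear change of variables in
`Φ₁ ⊗ Φ̄₂` followed by a Fourier transform in one variable. `isSchwartzBruhat_partialFourier` shows
that such a transform stays in the Schwartz–Bruhat space. Over a totally disconnected field it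
exchanges invariance under small translations with compact support; over a real group it exchanges
derivatives with polynomial weights.

No classification of local fields is used. Self-duality is a condition tested on Schwartz–Bruhat
functions, so its uniqueness needs a non-zero one; and a non-zero `φ₁` on a non-zero space already
forces `F` to have a compact open neighbourhood of `0` or to be a real vector group
(`IsSchwartzBruhat.fieldType`). If `φ₁ = 0` or `Z = 0`, the claim is checked directly. -/

namespace Oscillator

/-! ### Partial Fourier transforms of Schwartz functions on real vector spaces. -/

section PartialFourier

open Complex
open scoped FourierTransform

variable {V V' W : Type} [NormedAddCommGroup V] [NormedSpace ℝ V] [FiniteDimensional ℝ V]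
  [MeasurableSpace V] [BorelSpace V]
  [NormedAddCommGroup V'] [NormedSpace ℝ V']
  [NormedAddCommGroup W] [NormedSpace ℝ W]

/-- The Fourier transform in the first variable of a function on `V × W`. -/
noncomputable def partialFourier {E : Type} [NormedAddCommGroup E] [NormedSpace ℂ E]
    (μ : Measure V) (β : V →L[ℝ] V' →L[ℝ] ℝ) (g : V × W → E) (p : V' × W) : E :=
  ∫ x, (Real.fourierChar (-β x p.1) : ℂ) • g (x, p.2) ∂μ

/-- The function whose partial Fourier transform is the derivative of that of `g`. -/
noncomputable def partialFourierDeriv {E : Type} [NormedAddCommGroup E] [NormedSpace ℂ E]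
    (β : V →L[ℝ] V' →L[ℝ] ℝ) (g : 𝓢(V × W, E)) : 𝓢(V × W, (V' × W) →L[ℝ] E) :=
  (-(2 * Real.pi * I)) • SchwartzMap.smulRightCLM ℂ E
      (((ContinuousLinearMap.compL ℝ (V' × W) V' ℝ).flip (ContinuousLinearMap.fst ℝ V' W)) ∘L
        β ∘L ContinuousLinearMap.fst ℝ V W) g +
    SchwartzMap.postcompCLM (ContinuousLinearMap.precomp E
      (ContinuousLinearMap.inr ℝ V W ∘L ContinuousLinearMap.snd ℝ V' W))
      (SchwartzMap.fderivCLM ℝ (V × W) E g)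

variable {E : Type} [NormedAddCommGroup E] [NormedSpace ℂ E]

theorem partialFourierDeriv_apply (β : V →L[ℝ] V' →L[ℝ] ℝ) (g : 𝓢(V × W, E)) (x : V) (w : W)
    (p : V' × W) : partialFourierDeriv β g (x, w) p =
      (-(2 * Real.pi * I)) • (β x p.1 • g (x, w)) + fderiv ℝ g (x, w) (0, p.2) := by
  simp [partialFourierDeriv]

/-- Decay in `x` uniform in `w`, with a power of `‖w‖` to spare. It supplies every dominating
function below. -/
theorem exists_bound_prod (g : 𝓢(V × W, E)) (j N : ℕ) :
    ∃ C, 0 ≤ C ∧ ∀ x w, ‖w‖ ^ j * ‖g (x, w)‖ ≤ C * (1 + ‖x‖) ^ (-(N : ℝ)) := by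
  refine ⟨2 ^ (N + j) * ((Finset.Iic (N + j, 0)).sup
    fun m => SchwartzMap.seminorm ℝ m.1 m.2) g, by positivity, fun x w => ?_⟩
  -- Order `N + j` pays for both factors, as `‖x‖` and `‖w‖` are each at most `‖(x, w)‖`.
  have h := SchwartzMap.one_add_le_sup_seminorm_apply (𝕜 := ℝ) (m := (N + j, 0)) (k := N + j)
    (n := 0) le_rfl le_rfl g (x, w)
  rw [norm_iteratedFDeriv_zero, pow_add] at h
  rw [Real.rpow_neg (by positivity), Real.rpow_natCast, ← div_eq_mul_inv,
    le_div_iff₀ (by positivity)]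
  refine le_trans ?_ h
  have h1 : ‖x‖ ≤ ‖(x, w)‖ := norm_fst_le (x, w)
  have h2 : ‖w‖ ≤ 1 + ‖(x, w)‖ := (norm_snd_le (x, w)).trans (by simp)
  calc ‖w‖ ^ j * ‖g (x, w)‖ * (1 + ‖x‖) ^ N = (1 + ‖x‖) ^ N * ‖w‖ ^ j * ‖g (x, w)‖ := by ring
    _ ≤ _ := by gcongr

theorem integrable_slice (μ : Measure V) [μ.IsAddHaarMeasure] (g : 𝓢(V × W, E)) (w : W) :
    Integrable (fun x => g (x, w)) μ := by
  -- The exponent is one more than the dimension, so that `(1 + ‖x‖)` to the opposite power is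
  -- integrable.
  obtain ⟨C, -, hC⟩ := exists_bound_prod g 0 (Module.finrank ℝ V + 1)
  refine Integrable.mono' (g := fun x => C * (1 + ‖x‖) ^ (-((Module.finrank ℝ V + 1 : ℕ) : ℝ))) ?_
    (g.continuous.comp (by fun_prop)).aestronglyMeasurable (Filter.Eventually.of_forall fun x => ?_)
  · exact (integrable_one_add_norm (by push_cast; linarith)).const_mul C
  · simpa using hC x w

/-- Differentiation under the integral: the phase contributes `-2πi β`, the slice contributes the
derivative in `w`. The result is again a partial transform of a Schwartz function, which lets
induction on the order of derivatives run. -/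
theorem hasFDerivAt_partialFourier (μ : Measure V) [μ.IsAddHaarMeasure]
    (β : V →L[ℝ] V' →L[ℝ] ℝ) (g : 𝓢(V × W, E)) (p : V' × W) :
    HasFDerivAt (partialFourier μ β g) (partialFourier μ β (partialFourierDeriv β g) p) p := by
  obtain ⟨C, -, hC⟩ := exists_bound_prod (partialFourierDeriv β g) 0 (Module.finrank ℝ V + 1)
  refine hasFDerivAt_integral_of_dominated_of_fderiv_le (𝕜 := ℝ) (s := Set.univ)
    (F := fun p x => (Real.fourierChar (-β x p.1) : ℂ) • g (x, p.2))
    (F' := fun p x => (Real.fourierChar (-β x p.1) : ℂ) • partialFourierDeriv β g (x, p.2))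
    (bound := fun x : V => C * (1 + ‖x‖) ^ (-((Module.finrank ℝ V + 1 : ℕ) : ℝ)))
    Filter.univ_mem ?_ ?_ ?_ ?_ ?_ ?_
  · refine Filter.Eventually.of_forall fun p => Continuous.aestronglyMeasurable ?_
    have := g.continuous
    fun_prop
  · refine (integrable_slice μ g p.2).norm.mono' ?_ (Filter.Eventually.of_forall fun x => ?_)
    · have := g.continuous
      exact Continuous.aestronglyMeasurable (by fun_prop)
    · rw [norm_smul, Circle.norm_coe, one_mul]
  · have := (partialFourierDeriv β g).continuous
    exact Continuous.aestronglyMeasurable (by fun_prop)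
  · refine Filter.Eventually.of_forall fun x p _ => ?_
    rw [norm_smul, Circle.norm_coe, one_mul]
    simpa using hC x p.2
  · exact (integrable_one_add_norm (by push_cast; linarith)).const_mul C
  · refine Filter.Eventually.of_forall fun x p _ => ?_
    have h1 : HasFDerivAt (fun p : V' × W => (Real.fourierChar (-β x p.1) : ℂ))
        ((-2 * Real.pi * I * (Real.fourierChar (-β x p.1) : ℂ)) •
          (Complex.ofRealCLM ∘L (β x) ∘L ContinuousLinearMap.fst ℝ V' W)) p := by
      have := (Real.hasFDerivAt_fourierChar_neg_bilinear_right β x p.1).comp p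
        (hasFDerivAt_fst (𝕜 := ℝ) (E := V') (F := W))
      exact this
    have h2 : HasFDerivAt (fun p : V' × W => g (x, p.2))
        (fderiv ℝ g (x, p.2) ∘L
          (ContinuousLinearMap.inr ℝ V W ∘L ContinuousLinearMap.snd ℝ V' W)) p := by
      have h3 : HasFDerivAt (fun p : V' × W => (x, p.2))
          (ContinuousLinearMap.inr ℝ V W ∘L ContinuousLinearMap.snd ℝ V' W) p :=
        (hasFDerivAt_const x p).prodMk (hasFDerivAt_snd (𝕜 := ℝ))
      exact HasFDerivAt.comp p (g.differentiableAt (x := (x, p.2))).hasFDerivAt h3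
    refine (h1.smul h2).congr_fderiv ?_
    refine ContinuousLinearMap.ext fun q => ?_
    change _ = (Real.fourierChar (-β x p.1) : ℂ) • (partialFourierDeriv β g (x, p.2) q)
    rw [partialFourierDeriv_apply]
    simp only [add_apply, smul_apply, ContinuousLinearMap.smulRight_apply,
      ContinuousLinearMap.comp_apply, ContinuousLinearMap.coe_fst', ContinuousLinearMap.coe_snd',
      ContinuousLinearMap.inr_apply, Complex.ofRealCLM_apply, smul_add, smul_eq_mul]
    rw [add_comm, ← Complex.coe_smul (β x q.1), smul_smul, smul_smul]
    congr 2
    ring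

theorem fderiv_partialFourier (μ : Measure V) [μ.IsAddHaarMeasure]
    (β : V →L[ℝ] V' →L[ℝ] ℝ) (g : 𝓢(V × W, E)) :
    fderiv ℝ (partialFourier μ β g) = partialFourier μ β (partialFourierDeriv β g) :=
  funext fun p => (hasFDerivAt_partialFourier μ β g p).fderiv

/-- The value space is quantified inside the induction because each derivative replaces `E` by `(V'
× W) →L[ℝ] E`. -/
theorem contDiff_partialFourier (μ : Measure V) [μ.IsAddHaarMeasure]
    (β : V →L[ℝ] V' →L[ℝ] ℝ) (n : ℕ) :
    ∀ {E : Type} [NormedAddCommGroup E] [NormedSpace ℂ E] (g : 𝓢(V × W, E)),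
      ContDiff ℝ n (partialFourier μ β g) := by
  induction n with
  | zero =>
    intro E _ _ g
    exact contDiff_zero.2 (continuous_iff_continuousAt.2 fun p =>
      (hasFDerivAt_partialFourier μ β g p).continuousAt)
  | succ n ih =>
    intro E _ _ g
    push_cast
    refine contDiff_succ_iff_fderiv.2
      ⟨fun p => (hasFDerivAt_partialFourier μ β g p).differentiableAt, by simp, ?_⟩
    rw [fderiv_partialFourier]
    exact ih _

/-- The derivative of a Schwartz function in the first variable. -/
noncomputable def fderivFst (g : 𝓢(V × W, E)) : 𝓢(V × W, V →L[ℝ] E) :=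
  SchwartzMap.postcompCLM (ContinuousLinearMap.precomp E (ContinuousLinearMap.inl ℝ V W))
    (SchwartzMap.fderivCLM ℝ (V × W) E g)

theorem hasFDerivAt_slice (g : 𝓢(V × W, E)) (x : V) (w : W) :
    HasFDerivAt (fun x => g (x, w)) (fderivFst g (x, w)) x := by
  have h3 : HasFDerivAt (fun x : V => (x, w)) (ContinuousLinearMap.inl ℝ V W) x :=
    (hasFDerivAt_id x).prodMk (hasFDerivAt_const w x)
  exact HasFDerivAt.comp x (g.differentiableAt (x := (x, w))).hasFDerivAt h3

/-- Integration by parts in `x`, slice by slice. -/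
theorem partialFourier_fderivFst (μ : Measure V) [μ.IsAddHaarMeasure]
    (β : V →L[ℝ] V' →L[ℝ] ℝ) (g : 𝓢(V × W, E)) (p : V' × W) :
    ‖partialFourier μ β (fderivFst g) p‖ =
      2 * Real.pi * (‖β.flip p.1‖ * ‖partialFourier μ β g p‖) := by
  have hd : fderiv ℝ (fun x => g (x, p.2)) = fun x => fderivFst g (x, p.2) :=
    funext fun x => (hasFDerivAt_slice g x p.2).fderiv
  have h := VectorFourier.fourierIntegral_fderiv (μ := μ) β (integrable_slice μ g p.2)
    (fun x => (hasFDerivAt_slice g x p.2).differentiableAt)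
    (by rw [hd]; exact integrable_slice μ (fderivFst g) p.2)
  rw [hd] at h
  have h' : partialFourier μ β (fderivFst g) p =
      VectorFourier.fourierSMulRight (-β.flip) (fun y => partialFourier μ β g (y, p.2)) p.1 :=
    congrFun h p.1
  rw [h', VectorFourier.norm_fourierSMulRight, neg_apply, norm_neg]
  ring

/-- Each factor `‖β.flip p.1‖` is traded for one derivative in the first variable; the factors
`‖p.2‖` are absorbed by the decay of `g` itself. -/
theorem exists_bound_partialFourier (μ : Measure V) [μ.IsAddHaarMeasure]
    (β : V →L[ℝ] V' →L[ℝ] ℝ) (i j : ℕ) :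
    ∀ {E : Type} [NormedAddCommGroup E] [NormedSpace ℂ E] (g : 𝓢(V × W, E)),
      ∃ C, ∀ p, ‖β.flip p.1‖ ^ i * ‖p.2‖ ^ j * ‖partialFourier μ β g p‖ ≤ C := by
  induction i with
  | zero =>
    intro E _ _ g
    obtain ⟨C, -, hC⟩ := exists_bound_prod g j (Module.finrank ℝ V + 1)
    refine ⟨∫ x, C * (1 + ‖x‖) ^ (-((Module.finrank ℝ V + 1 : ℕ) : ℝ)) ∂μ, fun p => ?_⟩
    rw [pow_zero, one_mul]
    calc ‖p.2‖ ^ j * ‖partialFourier μ β g p‖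
        ≤ ‖p.2‖ ^ j * ∫ x, ‖g (x, p.2)‖ ∂μ := by
          gcongr
          refine (norm_integral_le_integral_norm _).trans_eq ?_
          simp only [norm_smul, Circle.norm_coe, one_mul]
      _ = ∫ x, ‖p.2‖ ^ j * ‖g (x, p.2)‖ ∂μ := (integral_const_mul _ _).symm
      _ ≤ _ := by
          refine integral_mono ((integrable_slice μ g p.2).norm.const_mul _)
            ((integrable_one_add_norm (by push_cast; linarith)).const_mul C) fun x => hC x p.2
  | succ i ih =>
    intro E _ _ g
    obtain ⟨C, hC⟩ := ih (fderivFst g)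
    refine ⟨C / (2 * Real.pi), fun p => ?_⟩
    rw [le_div_iff₀ (by positivity)]
    refine (le_of_eq ?_).trans (hC p)
    rw [partialFourier_fderivFst]
    ring

/-- Derivatives are absorbed into `g` one at a time, leaving order zero. There `hK`, a quantitative
form of non-degeneracy, converts decay in `β.flip y` into decay in `y`. -/
theorem exists_bound_iteratedFDeriv_partialFourier (μ : Measure V) [μ.IsAddHaarMeasure]
    (β : V →L[ℝ] V' →L[ℝ] ℝ) {K : ℝ} (hK : ∀ y, ‖y‖ ≤ K * ‖β.flip y‖) (k n : ℕ) :
    ∀ {E : Type} [NormedAddCommGroup E] [NormedSpace ℂ E] (g : 𝓢(V × W, E)),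
      ∃ C, ∀ p, ‖p‖ ^ k * ‖iteratedFDeriv ℝ n (partialFourier μ β g) p‖ ≤ C := by
  induction n with
  | zero =>
    intro E _ _ g
    obtain ⟨C₁, h₁⟩ := exists_bound_partialFourier μ β k 0 g
    obtain ⟨C₂, h₂⟩ := exists_bound_partialFourier μ β 0 k g
    refine ⟨|K| ^ k * C₁ + C₂, fun p => ?_⟩
    rw [norm_iteratedFDeriv_zero]
    have h1 := h₁ p
    have h2 := h₂ p
    rw [pow_zero, mul_one] at h1
    rw [pow_zero, one_mul] at h2
    have h3 : ‖p.1‖ ^ k ≤ |K| ^ k * ‖β.flip p.1‖ ^ k := by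
      rw [← mul_pow]
      gcongr
      exact (hK p.1).trans (by gcongr; exact le_abs_self K)
    have h4 : ‖p‖ ^ k ≤ ‖p.1‖ ^ k + ‖p.2‖ ^ k := by
      rw [Prod.norm_def]
      rcases max_cases ‖p.1‖ ‖p.2‖ with h | h <;> rw [h.1] <;> simp
    calc ‖p‖ ^ k * ‖partialFourier μ β g p‖
        ≤ (|K| ^ k * ‖β.flip p.1‖ ^ k + ‖p.2‖ ^ k) * ‖partialFourier μ β g p‖ := by
          gcongr
          exact h4.trans (by gcongr)
      _ = |K| ^ k * (‖β.flip p.1‖ ^ k * ‖partialFourier μ β g p‖) +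
          ‖p.2‖ ^ k * ‖partialFourier μ β g p‖ := by ring
      _ ≤ _ := by gcongr
  | succ n ih =>
    intro E _ _ g
    obtain ⟨C, hC⟩ := ih (partialFourierDeriv β g)
    refine ⟨C, fun p => ?_⟩
    rw [← norm_iteratedFDeriv_fderiv, fderiv_partialFourier]
    exact hC p

/-- The partial Fourier transform of a Schwartz function, for a pairing that is non-degenerate on
the right, is a Schwartz function. -/
noncomputable def partialFourierSchwartz (μ : Measure V) [μ.IsAddHaarMeasure]
    (β : V →L[ℝ] V' →L[ℝ] ℝ) {K : ℝ} (hK : ∀ y, ‖y‖ ≤ K * ‖β.flip y‖) (g : 𝓢(V × W, E)) :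
    𝓢(V' × W, E) where
  toFun := partialFourier μ β g
  smooth' := contDiff_infty.2 fun n => contDiff_partialFourier μ β n g
  decay' := fun k n => exists_bound_iteratedFDeriv_partialFourier μ β hK k n g

end PartialFourier

/-! ### External products of Schwartz functions. -/

section Tensor

variable {V W : Type*} [NormedAddCommGroup V] [NormedSpace ℝ V]
  [NormedAddCommGroup W] [NormedSpace ℝ W]

/-- Used for the two projections of a product: as `‖L‖ ≤ 1`, the chain rule costs no constant. The
weight is `‖L u‖`, not `‖u‖`, since `f ∘ L` does not decay along the kernel of `L`. -/
theorem exists_bound_iteratedFDeriv_comp {V U : Type*} [NormedAddCommGroup V] [NormedSpace ℝ V]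
    [NormedAddCommGroup U] [NormedSpace ℝ U] (f : 𝓢(V, ℂ)) (L : U →L[ℝ] V) (hL : ‖L‖ ≤ 1)
    (k n : ℕ) : ∃ C, 0 ≤ C ∧ ∀ u, ‖L u‖ ^ k * ‖iteratedFDeriv ℝ n (f ∘ L) u‖ ≤ C := by
  obtain ⟨C, hC⟩ := f.decay' k n
  refine ⟨C, le_trans (by positivity) (hC 0), fun u => le_trans ?_ (hC (L u))⟩
  gcongr
  rw [L.iteratedFDeriv_comp_right (f.smooth ⊤) u (i := n) (by exact_mod_cast le_top)]
  refine (ContinuousMultilinearMap.norm_compContinuousLinearMap_le _ _).trans ?_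
  refine mul_le_of_le_one_right (norm_nonneg _) ?_
  simpa using pow_le_one₀ (norm_nonneg L) hL

/-- The external product of two Schwartz functions. -/
noncomputable def schwartzTensor (f : 𝓢(V, ℂ)) (g : 𝓢(W, ℂ)) : 𝓢(V × W, ℂ) where
  toFun p := f p.1 * g p.2
  smooth' := ((f.smooth ⊤).comp contDiff_fst).mul ((g.smooth ⊤).comp contDiff_snd)
  decay' := by
    intro k n
    have hf := exists_bound_iteratedFDeriv_comp f (ContinuousLinearMap.fst ℝ V W)
      (ContinuousLinearMap.norm_fst_le ℝ V W)
    have hg := exists_bound_iteratedFDeriv_comp g (ContinuousLinearMap.snd ℝ V W)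
      (ContinuousLinearMap.norm_snd_le ℝ V W)
    choose Cf hf0 hf using hf
    choose Cg hg0 hg using hg
    refine ⟨∑ i ∈ Finset.range (n + 1), (n.choose i : ℝ) *
      (Cf k i * Cg 0 (n - i) + Cf 0 i * Cg k (n - i)), fun p => ?_⟩
    have h4 : ‖p‖ ^ k ≤ ‖p.1‖ ^ k + ‖p.2‖ ^ k := by
      rw [Prod.norm_def]
      rcases max_cases ‖p.1‖ ‖p.2‖ with h | h <;> rw [h.1] <;> simp
    have h5 := norm_iteratedFDeriv_mul_le (n := n) (N := (⊤ : ℕ∞))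
      ((f.smooth ⊤).comp (ContinuousLinearMap.fst ℝ V W).contDiff)
      ((g.smooth ⊤).comp (ContinuousLinearMap.snd ℝ V W).contDiff) p
      (by exact_mod_cast le_top)
    refine (mul_le_mul h4 h5 (norm_nonneg _) (by positivity)).trans ?_
    rw [Finset.mul_sum]
    refine Finset.sum_le_sum fun i _ => ?_
    have a1 := hf k i p
    have a2 := hf 0 i p
    have b1 := hg k (n - i) p
    have b2 := hg 0 (n - i) p
    simp only [pow_zero, one_mul, ContinuousLinearMap.coe_fst', ContinuousLinearMap.coe_snd']
      at a1 a2 b1 b2 ⊢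
    set A := ‖iteratedFDeriv ℝ i (f ∘ Prod.fst) p‖
    set D := ‖iteratedFDeriv ℝ (n - i) (g ∘ Prod.snd) p‖
    calc (‖p.1‖ ^ k + ‖p.2‖ ^ k) * (n.choose i * A * D)
        = n.choose i * ((‖p.1‖ ^ k * A) * D + A * (‖p.2‖ ^ k * D)) := by ring
      _ ≤ _ := by
        gcongr
        · exact hf0 _ _
        · exact hf0 _ _

theorem schwartzTensor_apply (f : 𝓢(V, ℂ)) (g : 𝓢(W, ℂ)) (p : V × W) :
    schwartzTensor f g p = f p.1 * g p.2 := rfl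

end Tensor

/-! ### Quadratic phases as multipliers of Schwartz functions. -/

section Chirp

variable {V : Type*} [NormedAddCommGroup V] [NormedSpace ℝ V]

/-- Every derivative is a power of `I` times the function, hence has norm one. -/
theorem hasTemperateGrowth_exp_I :
    Function.HasTemperateGrowth (fun t : ℝ => Complex.exp (t * Complex.I)) := by
  have h : ∀ n : ℕ, iteratedDeriv n (fun t : ℝ => Complex.exp (t * Complex.I)) =
      fun t : ℝ => Complex.I ^ n * Complex.exp (t * Complex.I) := by
    intro n
    induction n with
    | zero => simp
    | succ n ih =>
      rw [iteratedDeriv_succ, ih]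
      funext t
      have h1 : HasDerivAt (fun t : ℝ => Complex.exp (t * Complex.I))
          (Complex.exp (t * Complex.I) * (1 * Complex.I)) t :=
        ((Complex.ofRealCLM.hasDerivAt (x := t)).mul_const Complex.I).cexp
      rw [(h1.const_mul (Complex.I ^ n)).deriv]
      ring
  refine ⟨Complex.ofRealCLM.contDiff.mul contDiff_const |>.cexp, fun n => ⟨0, 1, fun t => ?_⟩⟩
  rw [norm_iteratedFDeriv_eq_norm_iteratedDeriv, h n]
  simp [Complex.norm_exp_ofReal_mul_I]

/-- The exponent is a quadratic form, whose derivative `β + β.flip` is linear; the phase is its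
composition with `exp (t I)`. -/
theorem hasTemperateGrowth_chirp (β : V →L[ℝ] V →L[ℝ] ℝ) :
    Function.HasTemperateGrowth (fun x : V => Complex.exp ((β x x : ℝ) * Complex.I)) := by
  have hq : Function.HasTemperateGrowth (fun x : V => β x x) := by
    have hd : ∀ x, HasFDerivAt (fun x : V => β x x) ((β + β.flip) x) x := fun x => by
      refine ((β.hasFDerivAt (x := x)).clm_apply (hasFDerivAt_id x)).congr_fderiv ?_
      ext v
      simp
    refine Function.HasTemperateGrowth.of_fderiv (k := 2) (C := ‖β‖) ?_
      (fun x => (hd x).differentiableAt) fun x => ?_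
    · rw [show fderiv ℝ (fun x : V => β x x) = (β + β.flip : V →L[ℝ] V →L[ℝ] ℝ) from
        funext fun x => (hd x).fderiv]
      exact (β + β.flip).hasTemperateGrowth
    · refine (β.le_opNorm₂ x x).trans ?_
      rw [mul_assoc, ← sq]
      gcongr
      simp
  exact hasTemperateGrowth_exp_I.comp hq

end Chirp
-- The two types of local field, told apart by their additive groups.
section FieldType

/-- The topological group `F` is totally disconnected near the origin. -/
def HasCompactOpenNhd (F : Type*) [AddCommGroup F] [TopologicalSpace F] : Prop :=
  ∃ K : Set F, IsCompact K ∧ IsOpen K ∧ (0 : F) ∈ K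

/-- The topological group `F` is isomorphic to some `ℝⁿ`. -/
def IsRealGroup (F : Type*) [AddCommGroup F] [TopologicalSpace F] : Prop :=
  ∃ n : ℕ, Nonempty (F ≃ₜ+ EuclideanSpace ℝ (Fin n))

variable {F : Type*} [NontriviallyNormedField F] [LocallyCompactSpace F]
variable {M : Type*} [AddCommGroup M] [Module F M] [TopologicalSpace M] [IsTopologicalAddGroup M]
  [ContinuousSMul F M] [T2Space M] [FiniteDimensional F M]
variable {N : Type*} [AddCommGroup N] [Module F N] [TopologicalSpace N] [IsTopologicalAddGroup N]
  [ContinuousSMul F N] [T2Space N] [FiniteDimensional F N]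

/-- By connectedness a compact open neighbourhood of `0` would be all of `F`, which is not compact.
-/
theorem not_hasCompactOpenNhd_of_isRealGroup (h : IsRealGroup F) : ¬ HasCompactOpenNhd F := by
  rintro ⟨K, hK, hKo, h0⟩
  obtain ⟨n, ⟨e⟩⟩ := h
  have : ConnectedSpace F := e.toHomeomorph.symm.surjective.connectedSpace e.toHomeomorph.symm.continuous
  have hu : K = Set.univ := IsClopen.eq_univ ⟨hK.isClosed, hKo⟩ ⟨0, h0⟩
  have := NormedSpace.noncompactSpace F F
  exact noncompact_univ F (hu ▸ hK)

/-- The set is pulled back to `F` along an affine line through one of its points; lines are closed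
embeddings, so compactness survives. -/
theorem hasCompactOpenNhd_of_isCompact_isOpen [Nontrivial M] {K : Set M} (hK : IsCompact K)
    (hKo : IsOpen K) (hne : K.Nonempty) : HasCompactOpenNhd F := by
  have := completeSpace_field F
  obtain ⟨x₀, hx₀⟩ := hne
  obtain ⟨m, hm⟩ := exists_ne (0 : M)
  have hc : IsClosedEmbedding fun t : F => x₀ + t • m :=
    (Homeomorph.addLeft x₀).isClosedEmbedding.comp (isClosedEmbedding_smul_left hm)
  exact ⟨_, hc.isCompact_preimage hK, hKo.preimage hc.continuous, by simpa using hx₀⟩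

/-- The line `F m` is the image of a continuous additive projection of `M`. Transported to `ℝⁿ` this
projection is automatically real-linear, so its fixed points form a real subspace, isomorphic to
`F`. -/
theorem isRealGroup_of_nontrivial [Nontrivial M] (h : IsRealGroup M) : IsRealGroup F := by
  have := completeSpace_field F
  obtain ⟨n, ⟨e⟩⟩ := h
  obtain ⟨m, hm⟩ := exists_ne (0 : M)
  obtain ⟨p, hp⟩ := (LinearMap.toSpanSingleton F M m).exists_leftInverse_of_injective
    (LinearMap.ker_toSpanSingleton F hm)
  have hp' : ∀ t : F, p (t • m) = t := fun t => LinearMap.congr_fun hp t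
  have hpc : Continuous p := p.continuous_of_finiteDimensional
  let T : EuclideanSpace ℝ (Fin n) →+ EuclideanSpace ℝ (Fin n) :=
    { toFun := fun v => e (p (e.symm v) • m)
      map_zero' := by simp
      map_add' := fun v w => by simp [add_smul] }
  have hT : Continuous T := by
    change Continuous fun v => e (p (e.symm v) • m)
    exact e.continuous.comp ((hpc.comp e.symm.continuous).smul continuous_const)
  let S : Submodule ℝ (EuclideanSpace ℝ (Fin n)) :=
    LinearMap.eqLocus (T.toRealLinearMap hT : EuclideanSpace ℝ (Fin n) →ₗ[ℝ] _) LinearMap.id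
  have hS : ∀ v, v ∈ S ↔ e (p (e.symm v) • m) = v := fun v => Iff.rfl
  let j : F ≃ₜ+ S :=
    { toFun := fun t => ⟨e (t • m), by rw [hS]; simp [hp']⟩
      invFun := fun v => p (e.symm v)
      left_inv := fun t => by simp [hp']
      right_inv := fun v => Subtype.ext ((hS v).1 v.2)
      map_add' := fun s t => Subtype.ext (by simp [add_smul])
      continuous_toFun := by
        refine Continuous.subtype_mk (e.continuous.comp ?_) _
        fun_prop
      continuous_invFun := hpc.comp (e.symm.continuous.comp continuous_subtype_val) }
  exact ⟨_, ⟨j.trans (toEuclidean (E := S)).toContinuousAddEquiv⟩⟩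

theorem IsRealGroup.of_finiteDimensional (h : IsRealGroup F) : IsRealGroup M := by
  have := completeSpace_field F
  obtain ⟨k, ⟨e⟩⟩ := h
  have e₁ := ContinuousLinearEquiv.ofFinrankEq (𝕜 := F) (E := M)
    (F := Fin (Module.finrank F M) → F) (by simp)
  let e₂ : (Fin (Module.finrank F M) → F) ≃ₜ+
      (Fin (Module.finrank F M) → EuclideanSpace ℝ (Fin k)) :=
    { toFun := fun v i => e (v i)
      invFun := fun v i => e.symm (v i)
      left_inv := fun v => by simp
      right_inv := fun v => by simp
      map_add' := fun v w => by ext; simp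
      continuous_toFun := by
        have := e.continuous
        exact continuous_pi fun i => this.comp (continuous_apply i)
      continuous_invFun := by
        have := e.symm.continuous
        exact continuous_pi fun i => this.comp (continuous_apply i) }
  exact ⟨_, ⟨(e₁.toContinuousAddEquiv.trans e₂).trans toEuclidean.toContinuousAddEquiv⟩⟩

theorem HasCompactOpenNhd.of_finiteDimensional (F : Type*) [NontriviallyNormedField F]
    [LocallyCompactSpace F] {M : Type*} [AddCommGroup M] [Module F M] [TopologicalSpace M]
    [IsTopologicalAddGroup M] [ContinuousSMul F M] [T2Space M] [FiniteDimensional F M]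
    (h : HasCompactOpenNhd F) : HasCompactOpenNhd M := by
  have := completeSpace_field F
  obtain ⟨K, hK, hKo, h0⟩ := h
  have e := ContinuousLinearEquiv.ofFinrankEq (𝕜 := F) (E := M)
    (F := Fin (Module.finrank F M) → F) (by simp)
  refine ⟨e ⁻¹' Set.univ.pi fun _ => K, ?_, ?_, ?_⟩
  · exact e.toHomeomorph.isClosedEmbedding.isCompact_preimage (isCompact_univ_pi fun _ => hK)
  · exact (isOpen_set_pi Set.finite_univ fun _ _ => hKo).preimage e.continuous
  · simpa using fun _ => h0

/-! ### Characters -/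

/-- No small subgroups in the circle: for `t` near `0` all multiples of `t` stay near `0`, so all
powers of `ψ t` stay in an arc that contains no non-trivial subgroup. -/
theorem eventually_addChar_eq_one (h : HasCompactOpenNhd F) {ψ : AddChar F Circle}
    (hψ : Continuous ψ) : ∀ᶠ t in 𝓝 (0 : F), ψ t = 1 := by
  obtain ⟨K, hK, hKo, h0⟩ := h
  -- From `K + V ⊆ K` and `0 ∈ K`, all multiples of elements of `V` remain in the bounded set `K`.
  obtain ⟨V, hV, hKV⟩ := compact_open_separated_add_right hK hKo subset_rfl
  have hmul : ∀ v ∈ V, ∀ n : ℕ, n • v ∈ K := by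
    intro v hv n
    induction n with
    | zero => simpa using h0
    | succ n ih => rw [succ_nsmul]; exact hKV (Set.add_mem_add ih hv)
  obtain ⟨R, hR0, hR⟩ := hK.isBounded.exists_pos_norm_le
  have harc : ψ ⁻¹' Circle.centeredArc (Real.pi / 2) ∈ 𝓝 (0 : F) := by
    refine hψ.continuousAt.preimage_mem_nhds ?_
    rw [AddChar.map_zero_eq_one]
    have := Circle.hasBasis_centeredArc_div_two_pow.mem_of_mem (i := 0) trivial
    simpa using this
  obtain ⟨δ, hδ, hball⟩ := Metric.mem_nhds_iff.1 harc
  -- Scaling by `a` shrinks `K` into the ball of radius `δ`, so `a V` is the required neighbourhood.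
  obtain ⟨a, ha0, ha⟩ := NormedField.exists_norm_lt F (div_pos hδ hR0)
  have ha' : a ≠ 0 := norm_pos_iff.1 ha0
  have hnhd : (fun t => a⁻¹ * t) ⁻¹' V ∈ 𝓝 (0 : F) :=
    (continuous_const_mul a⁻¹).continuousAt.preimage_mem_nhds (by simpa using hV)
  filter_upwards [hnhd] with t ht
  refine Circle.eq_one_of_forall_pow_mem_centeredArc_pi_div_two fun n _ => ?_
  rw [← AddChar.map_nsmul_eq_pow]
  refine hball ?_
  have h1 : n • t = a * (n • (a⁻¹ * t)) := by
    rw [mul_smul_comm, mul_inv_cancel_left₀ ha']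
  rw [h1, mem_ball_zero_iff, norm_mul]
  calc ‖a‖ * ‖n • (a⁻¹ * t)‖ ≤ ‖a‖ * R := by
        gcongr
        exact hR _ (hmul _ ht n)
    _ < δ := (lt_div_iff₀ hR0).1 ha

theorem isLocallyConstant_addChar (h : HasCompactOpenNhd F) {ψ : AddChar F Circle}
    (hψ : Continuous ψ) : IsLocallyConstant ψ := by
  refine (IsLocallyConstant.iff_eventually_eq _).2 fun x => ?_
  have h1 : Filter.Tendsto (fun y => y - x) (𝓝 x) (𝓝 0) := by
    have : Continuous fun y : F => y - x := by fun_prop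
    simpa using this.tendsto x
  filter_upwards [h1.eventually (eventually_addChar_eq_one h hψ)] with y hy
  rw [← sub_add_cancel y x, AddChar.map_add_eq_mul, hy, one_mul]

/-- Lift `χ` through the covering `Circle.exp` with value `0` at `0`. The failure of additivity of
the lift is a continuous function with values in `2πℤ` that vanishes at the origin, hence is zero;
continuous additive maps are real-linear. -/
theorem exists_eq_exp_of_continuous {V : Type*} [NormedAddCommGroup V] [NormedSpace ℝ V]
    {χ : V → Circle} (hχ : Continuous χ) (hadd : ∀ x y, χ (x + y) = χ x * χ y) :
    ∃ l : V →L[ℝ] ℝ, ∀ x, χ x = Circle.exp (l x) := by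
  have h0 : χ 0 = 1 := by simpa using hadd 0 0
  obtain ⟨f, ⟨hf0, hf⟩, -⟩ := Circle.isCoveringMap_exp.existsUnique_continuousMap_lifts
    ⟨χ, hχ⟩ 0 0 (by simp [h0])
  have hf' : ∀ x, Circle.exp (f x) = χ x := fun x => congrFun hf x
  have hadd' : ∀ x y, f (x + y) = f x + f y := by
    intro x y
    have key : ∀ z : V × V, ∃ n : ℤ, f (z.1 + z.2) - f z.1 - f z.2 = n * (2 * Real.pi) := by
      intro z
      rw [← Circle.exp_eq_one, Circle.exp_sub, Circle.exp_sub, hf', hf', hf', hadd]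
      simp
    choose n hn using key
    have hc : Continuous fun z : V × V => (n z : ℝ) := by
      have : (fun z : V × V => (n z : ℝ)) =
          fun z => (f (z.1 + z.2) - f z.1 - f z.2) / (2 * Real.pi) := by
        funext z
        rw [hn z]
        field_simp
      rw [this]
      fun_prop
    have hc' : Continuous n := Int.isClosedEmbedding_coe_real.isEmbedding.continuous_iff.2 hc
    have h1 : n (x, y) = n (0, 0) :=
      isPreconnected_univ.constant hc'.continuousOn trivial trivial
    have h2 : n (0, 0) = 0 := by
      have := hn (0, 0)
      simp only [add_zero, hf0, sub_zero] at this
      have h3 : (n (0, 0) : ℝ) = 0 := by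
        rcases mul_eq_zero.1 this.symm with h | h
        · exact h
        · exact absurd h (by positivity)
      exact_mod_cast h3
    have h4 := hn (x, y)
    rw [h1, h2] at h4
    simp only [Int.cast_zero, zero_mul] at h4
    linarith
  exact ⟨AddMonoidHom.toRealLinearMap ⟨⟨f, hf0⟩, hadd'⟩ f.continuous, fun x => (hf' x).symm⟩

/-- The real structures carried by `e`, `e'` and `F` need not be related in advance: biadditivity
and continuity in each variable already give real bilinearity. -/
theorem exists_bilinear_of_isRealGroup (h : IsRealGroup F) {ψ : AddChar F Circle}
    (hψ : Continuous ψ) (b : M →ₗ[F] N →ₗ[F] F)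
    {V V' : Type*} [NormedAddCommGroup V] [NormedSpace ℝ V] [FiniteDimensional ℝ V]
    [NormedAddCommGroup V'] [NormedSpace ℝ V'] [FiniteDimensional ℝ V']
    (e : M ≃ₜ+ V) (e' : N ≃ₜ+ V') :
    ∃ β : V →L[ℝ] V' →L[ℝ] ℝ, ∀ x y, ψ (b x y) = Circle.exp (β (e x) (e' y)) := by
  have := completeSpace_field F
  obtain ⟨k, ⟨j⟩⟩ := h
  obtain ⟨l, hl⟩ := exists_eq_exp_of_continuous (χ := fun v => ψ (j.symm v))
    (hψ.comp j.symm.continuous) (fun x y => by simp [AddChar.map_add_eq_mul])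
  let B₀ : V → V' → ℝ := fun v v' => l (j (b (e.symm v) (e'.symm v')))
  have h1 : ∀ v v₂ v', B₀ (v + v₂) v' = B₀ v v' + B₀ v₂ v' := fun v v₂ v' => by simp [B₀]
  have h2 : ∀ v v' v₂', B₀ v (v' + v₂') = B₀ v v' + B₀ v v₂' := fun v v' v₂' => by simp [B₀]
  have c1 : ∀ v', Continuous fun v => B₀ v v' := fun v' => by
    have : Continuous (b.flip (e'.symm v')) := LinearMap.continuous_of_finiteDimensional _
    exact l.continuous.comp (j.continuous.comp (this.comp e.symm.continuous))
  have c2 : ∀ v, Continuous fun v' => B₀ v v' := fun v => by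
    have : Continuous (b (e.symm v)) := LinearMap.continuous_of_finiteDimensional _
    exact l.continuous.comp (j.continuous.comp (this.comp e'.symm.continuous))
  let B₁ : V →ₗ[ℝ] V' →ₗ[ℝ] ℝ := LinearMap.mk₂ ℝ B₀ h1
    (fun c v v' => map_real_smul (AddMonoidHom.mk' (fun v => B₀ v v') fun v w => h1 v w v')
      (c1 v') c v) h2
    (fun c v v' => map_real_smul (AddMonoidHom.mk' (fun v' => B₀ v v') fun w w' => h2 v w w')
      (c2 v) c v')
  refine ⟨LinearMap.toContinuousLinearMap
    ((LinearMap.toContinuousLinearMap : (V' →ₗ[ℝ] ℝ) ≃ₗ[ℝ] V' →L[ℝ] ℝ).toLinearMap ∘ₗ B₁),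
    fun x y => ?_⟩
  change _ = Circle.exp (l (j (b (e.symm (e x)) (e'.symm (e' y)))))
  rw [← hl]
  simp

end FieldType
-- Operations that preserve Schwartz–Bruhat functions.
section SchwartzBruhat

variable {F : Type*} [NontriviallyNormedField F] [LocallyCompactSpace F]
variable {M : Type*} [AddCommGroup M] [Module F M] [TopologicalSpace M] [IsTopologicalAddGroup M]
  [ContinuousSMul F M] [T2Space M] [FiniteDimensional F M]
variable {N : Type*} [AddCommGroup N] [Module F N] [TopologicalSpace N] [IsTopologicalAddGroup N]
  [ContinuousSMul F N] [T2Space N] [FiniteDimensional F N]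
variable {P : Type*} [AddCommGroup P] [Module F P] [TopologicalSpace P] [IsTopologicalAddGroup P]
  [ContinuousSMul F P] [T2Space P] [FiniteDimensional F P]

theorem IsSchwartzBruhat.comp_equiv {G H : Type*} [AddCommGroup G] [TopologicalSpace G]
    [AddCommGroup H] [TopologicalSpace H] {f : H → ℂ} (hf : IsSchwartzBruhat f) (e : G ≃ₜ+ H) :
    IsSchwartzBruhat fun x => f (e x) := by
  rcases hf with ⟨h1, h2⟩ | ⟨n, e', g, hg⟩
  · exact Or.inl ⟨h1.comp_continuous e.continuous, h2.comp_homeomorph e.toHomeomorph⟩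
  · exact Or.inr ⟨n, e.trans e', g, fun x => hg _⟩

theorem IsSchwartzBruhat.const_mul {G : Type*} [AddCommGroup G] [TopologicalSpace G] {f : G → ℂ}
    (hf : IsSchwartzBruhat f) (c : ℂ) : IsSchwartzBruhat fun x => c * f x := by
  rcases hf with ⟨h1, h2⟩ | ⟨n, e', g, hg⟩
  · exact Or.inl ⟨h1.comp (c * ·), h2.mul_left⟩
  · exact Or.inr ⟨n, e', c • g, fun x => by simp [hg]⟩

theorem IsSchwartzBruhat.star {G : Type*} [AddCommGroup G] [TopologicalSpace G] {f : G → ℂ}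
    (hf : IsSchwartzBruhat f) : IsSchwartzBruhat fun x => star (f x) := by
  rcases hf with ⟨h1, h2⟩ | ⟨n, e', g, hg⟩
  · exact Or.inl ⟨h1.comp Star.star, h2.comp_left (g := Star.star) (star_zero ℂ)⟩
  · exact Or.inr ⟨n, e', SchwartzMap.postcompCLM (𝕜 := ℝ) (Complex.conjCLE : ℂ →L[ℝ] ℂ) g,
      fun x => by simp [hg]⟩

theorem isSchwartzBruhat_of_subsingleton {G : Type*} [AddCommGroup G] [TopologicalSpace G]
    [Subsingleton G] (f : G → ℂ) : IsSchwartzBruhat f :=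
  Or.inl ⟨.of_discrete f, HasCompactSupport.of_compactSpace f⟩

theorem hasCompactOpenNhd_of_isLocallyConstant (F : Type*) [NontriviallyNormedField F]
    [LocallyCompactSpace F] {M : Type*} [AddCommGroup M] [Module F M] [TopologicalSpace M]
    [IsTopologicalAddGroup M] [ContinuousSMul F M] [T2Space M] [FiniteDimensional F M]
    [Nontrivial M] {f : M → ℂ} (h1 : IsLocallyConstant f)
    (h2 : HasCompactSupport f) {x : M} (hx : f x ≠ 0) : HasCompactOpenNhd F := by
  have hc : IsClosed {x | f x ≠ 0} := (h1.isOpen_fiber 0).isClosed_compl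
  refine hasCompactOpenNhd_of_isCompact_isOpen (M := M) (K := {x | f x ≠ 0}) ?_
    (h1.isClosed_fiber 0).isOpen_compl ⟨x, hx⟩
  exact IsCompact.of_isClosed_subset h2 hc subset_closure

/-- A non-zero Schwartz–Bruhat function on a non-zero space determines the type of the field. -/
theorem IsSchwartzBruhat.fieldType (F : Type*) [NontriviallyNormedField F]
    [LocallyCompactSpace F] {M : Type*} [AddCommGroup M] [Module F M] [TopologicalSpace M]
    [IsTopologicalAddGroup M] [ContinuousSMul F M] [T2Space M] [FiniteDimensional F M]
    [Nontrivial M] {f : M → ℂ} (hf : IsSchwartzBruhat f)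
    {x : M} (hx : f x ≠ 0) : HasCompactOpenNhd F ∨ IsRealGroup F := by
  rcases hf with ⟨h1, h2⟩ | ⟨n, e, -, -⟩
  · exact Or.inl (hasCompactOpenNhd_of_isLocallyConstant F h1 h2 hx)
  · exact Or.inr (isRealGroup_of_nontrivial (M := M) ⟨n, ⟨e⟩⟩)

/-- On a non-zero space the Archimedean alternative would make `F` a real group; on the zero space
every function qualifies. -/
theorem isSchwartzBruhat_iff_of_hasCompactOpenNhd (h : HasCompactOpenNhd F) {f : M → ℂ} :
    IsSchwartzBruhat f ↔ IsLocallyConstant f ∧ HasCompactSupport f := by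
  refine ⟨fun hf => ?_, Or.inl⟩
  rcases hf with hf | ⟨n, e, -, -⟩
  · exact hf
  rcases subsingleton_or_nontrivial M with hM | hM
  · exact ⟨.of_discrete f, HasCompactSupport.of_compactSpace f⟩
  · exact absurd h (not_hasCompactOpenNhd_of_isRealGroup
      (isRealGroup_of_nontrivial (M := M) ⟨n, ⟨e⟩⟩))

theorem exists_schwartzMap_ne_zero (V : Type*) [NormedAddCommGroup V] [NormedSpace ℝ V]
    [FiniteDimensional ℝ V] : ∃ g : 𝓢(V, ℂ), g 0 = 1 := by
  let f : ContDiffBump (0 : V) := default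
  have h1 : HasCompactSupport fun x => (f x : ℂ) :=
    f.hasCompactSupport.comp_left (g := Complex.ofReal) Complex.ofReal_zero
  have h2 : ContDiff ℝ (⊤ : ℕ∞) fun x => (f x : ℂ) := Complex.ofRealCLM.contDiff.comp f.contDiff
  refine ⟨h1.toSchwartzMap h2, ?_⟩
  change (f 0 : ℂ) = 1
  exact_mod_cast f.one_of_mem_closedBall (by simp [f.rIn_pos.le])

/-- Frees the definition from its particular Euclidean coordinates: any real coordinates on `M`
serve. -/
theorem isSchwartzBruhat_iff_of_isRealGroup (h : IsRealGroup F) {V : Type*}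
    [NormedAddCommGroup V] [NormedSpace ℝ V] [FiniteDimensional ℝ V] (e : M ≃ₜ+ V) {f : M → ℂ} :
    IsSchwartzBruhat f ↔ ∃ g : 𝓢(V, ℂ), ∀ x, f x = g (e x) := by
  constructor
  · rintro (⟨h1, h2⟩ | ⟨n, e', g, hg⟩)
    · rcases subsingleton_or_nontrivial M with hM | hM
      · obtain ⟨g, hg⟩ := exists_schwartzMap_ne_zero V
        refine ⟨f 0 • g, fun x => ?_⟩
        rw [Subsingleton.elim x 0]
        simp [hg]
      -- A non-zero value of a locally constant `f` with compact support would give a compact open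
      -- set, impossible here; so `f = 0`.
      · refine ⟨0, fun x => ?_⟩
        by_contra hx
        exact not_hasCompactOpenNhd_of_isRealGroup h (hasCompactOpenNhd_of_isLocallyConstant F h1 h2 hx)
    · let j : V ≃L[ℝ] EuclideanSpace ℝ (Fin n) :=
        (e.symm.trans e').toAddEquiv.toRealLinearEquiv (e.symm.trans e').continuous
          (e.symm.trans e').symm.continuous
      refine ⟨SchwartzMap.compCLMOfContinuousLinearEquiv ℝ j g, fun x => ?_⟩
      rw [hg]
      change g (e' x) = g (e' (e.symm (e x)))
      simp
  · rintro ⟨g, hg⟩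
    refine Or.inr ⟨_, e.trans (toEuclidean (E := V)).toContinuousAddEquiv,
      SchwartzMap.compCLMOfContinuousLinearEquiv ℝ (toEuclidean (E := V)).symm g, fun x => ?_⟩
    rw [hg]
    change g (e x) = g (toEuclidean.symm (toEuclidean (e x)))
    simp

/-- Provides the test function that makes self-duality determine a measure. -/
theorem exists_isSchwartzBruhat_ne_zero (hF : HasCompactOpenNhd F ∨ IsRealGroup F) :
    ∃ (f : M → ℂ) (x : M), IsSchwartzBruhat f ∧ f x ≠ 0 := by
  classical
  rcases hF with h | h
  · obtain ⟨K, hK, hKo, h0⟩ := HasCompactOpenNhd.of_finiteDimensional F (M := M) h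
    refine ⟨K.indicator 1, 0, Or.inl ⟨?_, ?_⟩, by simp [h0]⟩
    · rw [← LocallyConstant.coe_charFn ℂ ⟨hK.isClosed, hKo⟩]
      exact LocallyConstant.isLocallyConstant _
    · exact HasCompactSupport.intro hK fun x hx => Set.indicator_of_notMem hx _
  · obtain ⟨n, ⟨e⟩⟩ := h.of_finiteDimensional (M := M)
    obtain ⟨g, hg⟩ := exists_schwartzMap_ne_zero (EuclideanSpace ℝ (Fin n))
    exact ⟨fun x => g (e x), 0, Or.inr ⟨n, e, g, fun x => rfl⟩, by simp [hg]⟩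

/-- The product of two isomorphisms of topological groups. -/
def prodContinuousAddEquiv {G H G' H' : Type*} [AddCommGroup G] [TopologicalSpace G]
    [AddCommGroup H] [TopologicalSpace H] [AddCommGroup G'] [TopologicalSpace G']
    [AddCommGroup H'] [TopologicalSpace H'] (e : G ≃ₜ+ G') (e' : H ≃ₜ+ H') :
    (G × H) ≃ₜ+ (G' × H') :=
  { e.toAddEquiv.prodCongr e'.toAddEquiv with
    continuous_toFun := e.continuous.prodMap e'.continuous
    continuous_invFun := e.symm.continuous.prodMap e'.symm.continuous }

theorem continuous_bilinear (b : M →ₗ[F] N →ₗ[F] P) :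
    Continuous fun z : M × N => b z.1 z.2 := by
  have := completeSpace_field F
  let v := Module.finBasis F N
  have h : (fun z : M × N => b z.1 z.2) = fun z => ∑ i, v.coord i z.2 • b.flip (v i) z.1 := by
    funext z
    conv_lhs => rw [← v.sum_repr z.2, map_sum]
    simp only [map_smul]
    rfl
  rw [h]
  refine continuous_finsetSum _ fun i _ => ?_
  have h1 : Continuous (v.coord i) := LinearMap.continuous_of_finiteDimensional _
  have h2 : Continuous (b.flip (v i)) := LinearMap.continuous_of_finiteDimensional _
  exact (h1.comp continuous_snd).smul (h2.comp continuous_fst)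

/-- Changing the complement of a Lagrangian multiplies the associated function by such a quadratic
phase. The phase is locally constant in the one case and of temperate growth in the other. -/
theorem IsSchwartzBruhat.mul_chirp (hF : HasCompactOpenNhd F ∨ IsRealGroup F)
    {ψ : AddChar F Circle} (hψ : Continuous ψ) (b : M →ₗ[F] M →ₗ[F] F) {f : M → ℂ}
    (hf : IsSchwartzBruhat f) : IsSchwartzBruhat fun x => (ψ (b x x) : ℂ) * f x := by
  rcases hF with h | h
  · obtain ⟨h1, h2⟩ := (isSchwartzBruhat_iff_of_hasCompactOpenNhd h).1 hf
    refine Or.inl ⟨?_, h2.mul_left⟩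
    refine IsLocallyConstant.mul (f := fun x => (ψ (b x x) : ℂ)) ?_ h1
    exact ((isLocallyConstant_addChar h hψ).comp ((↑) : Circle → ℂ)).comp_continuous
      ((continuous_bilinear b).comp (continuous_id.prodMk continuous_id))
  · obtain ⟨n, ⟨e⟩⟩ := h.of_finiteDimensional (M := M)
    obtain ⟨g, hg⟩ := (isSchwartzBruhat_iff_of_isRealGroup h e).1 hf
    obtain ⟨β, hβ⟩ := exists_bilinear_of_isRealGroup h hψ b e e
    refine (isSchwartzBruhat_iff_of_isRealGroup h e).2
      ⟨SchwartzMap.smulLeftCLM ℂ (fun x => Complex.exp ((β x x : ℝ) * Complex.I)) g, fun x => ?_⟩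
    rw [SchwartzMap.smulLeftCLM_apply_apply (hasTemperateGrowth_chirp β), hg, hβ,
      Circle.coe_exp, smul_eq_mul]

theorem IsSchwartzBruhat.tensor (hF : HasCompactOpenNhd F ∨ IsRealGroup F)
    {f : M → ℂ} {g : N → ℂ} (hf : IsSchwartzBruhat f) (hg : IsSchwartzBruhat g) :
    IsSchwartzBruhat fun p : M × N => f p.1 * g p.2 := by
  rcases hF with h | h
  · obtain ⟨h1, h2⟩ := (isSchwartzBruhat_iff_of_hasCompactOpenNhd h).1 hf
    obtain ⟨h3, h4⟩ := (isSchwartzBruhat_iff_of_hasCompactOpenNhd h).1 hg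
    refine Or.inl ⟨(h1.comp_continuous continuous_fst).mul (h3.comp_continuous continuous_snd),
      HasCompactSupport.intro (h2.prod h4) fun p hp => ?_⟩
    rw [Set.mem_prod, not_and_or] at hp
    rcases hp with hp | hp
    · rw [image_eq_zero_of_notMem_tsupport hp, zero_mul]
    · rw [image_eq_zero_of_notMem_tsupport hp, mul_zero]
  · obtain ⟨m, ⟨e⟩⟩ := h.of_finiteDimensional (M := M)
    obtain ⟨n, ⟨e'⟩⟩ := h.of_finiteDimensional (M := N)
    obtain ⟨g₁, hg₁⟩ := (isSchwartzBruhat_iff_of_isRealGroup h e).1 hf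
    obtain ⟨g₂, hg₂⟩ := (isSchwartzBruhat_iff_of_isRealGroup h e').1 hg
    refine (isSchwartzBruhat_iff_of_isRealGroup h (prodContinuousAddEquiv e e')).2
      ⟨schwartzTensor g₁ g₂, fun p => ?_⟩
    rw [schwartzTensor_apply, hg₁, hg₂]
    rfl

/-- Locally constant functions with compact support are invariant under small translations. -/
theorem eventually_translate_of_isLocallyConstant {G : Type*} [AddCommGroup G] [TopologicalSpace G]
    [IsTopologicalAddGroup G] {f : G → ℂ} (h1 : IsLocallyConstant f) (h2 : HasCompactSupport f) :
    ∀ᶠ u in 𝓝 (0 : G), ∀ z, f (z + u) = f z := by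
  have key : ∀ᶠ u in 𝓝 (0 : G), ∀ z ∈ tsupport f, f (z + u) = f z := by
    refine h2.isCompact.eventually_forall_of_forall_eventually fun z _ => ?_
    have hA : IsLocallyConstant fun p : G × G => f (p.2 + p.1) :=
      h1.comp_continuous (continuous_snd.add continuous_fst)
    have hB : IsLocallyConstant fun p : G × G => f p.2 := h1.comp_continuous continuous_snd
    filter_upwards [hA.eventually_eq (0, z), hB.eventually_eq (0, z)] with p hp hp'
    rw [hp, hp', add_zero]
  -- Translation by `-u` is needed for points outside the support that `u` moves into it.
  have hneg : ∀ᶠ u in 𝓝 (0 : G), ∀ z ∈ tsupport f, f (z + -u) = f z := by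
    have : Filter.Tendsto (fun u : G => -u) (𝓝 0) (𝓝 0) := by
      simpa using (continuous_neg (G := G)).tendsto 0
    exact this.eventually key
  filter_upwards [key, hneg] with u hu hu' z
  by_cases hz : z ∈ tsupport f
  · exact hu z hz
  by_cases hz' : z + u ∈ tsupport f
  · simpa using (hu' _ hz').symm
  · rw [image_eq_zero_of_notMem_tsupport hz, image_eq_zero_of_notMem_tsupport hz']

/-- The annihilator of a neighbourhood of `0` is bounded: if some coordinate `b (v i) y` is too
large, a small multiple of `v i` pairs with `y` to a fixed `t₀` at which `ψ` is non-trivial. -/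
theorem exists_isCompact_of_addChar_eq_one {ψ : AddChar F Circle} (hψ1 : ψ ≠ 1)
    (b : M →ₗ[F] P →ₗ[F] F) (hb : ∀ y, (∀ x, b x y = 0) → y = 0) {U : Set M} (hU : U ∈ 𝓝 (0 : M)) :
    ∃ K : Set P, IsCompact K ∧ ∀ y, (∀ x ∈ U, ψ (b x y) = 1) → y ∈ K := by
  have := completeSpace_field F
  have : ProperSpace F := .of_nontriviallyNormedField_of_weaklyLocallyCompactSpace F
  obtain ⟨t₀, ht₀⟩ := AddChar.ne_one_iff.1 hψ1
  let v := Module.finBasis F M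
  have h1 : ∀ᶠ t in 𝓝 (0 : F), ∀ i, t • v i ∈ U := by
    refine Filter.eventually_all.2 fun i => ?_
    have : Continuous fun t : F => t • v i := by fun_prop
    exact this.continuousAt.preimage_mem_nhds (by simpa using hU)
  obtain ⟨δ, hδ, hball⟩ := Metric.eventually_nhds_iff_ball.1 h1
  let A : P →ₗ[F] (Fin (Module.finrank F M) → F) := LinearMap.pi fun i => b (v i)
  have hA : LinearMap.ker A = ⊥ := by
    refine LinearMap.ker_eq_bot'.2 fun y hy => hb y fun x => ?_
    have h2 : b.flip y = 0 := v.ext fun i => congrFun hy i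
    exact LinearMap.congr_fun h2 x
  -- Non-degeneracy makes `A` injective, hence a closed embedding, so bounded coordinates cut out a
  -- compact set.
  refine ⟨A ⁻¹' Metric.closedBall 0 (‖t₀‖ / δ), (LinearMap.isClosedEmbedding_of_injective
    hA).isCompact_preimage (isCompact_closedBall _ _), fun y hy => ?_⟩
  rw [Set.mem_preimage, mem_closedBall_zero_iff, pi_norm_le_iff_of_nonneg (by positivity)]
  intro i
  change ‖b (v i) y‖ ≤ _
  by_contra! hlt
  have h0 : b (v i) y ≠ 0 := by
    intro h
    rw [h, norm_zero] at hlt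
    exact absurd hlt (not_lt.2 (by positivity))
  have h3 : (t₀ / b (v i) y) • v i ∈ U := by
    refine hball _ ?_ i
    rw [mem_ball_zero_iff, norm_div, div_lt_iff₀ (norm_pos_iff.2 h0)]
    rwa [div_lt_iff₀ hδ, mul_comm] at hlt
  have h4 := hy _ h3
  rw [map_smul, LinearMap.smul_apply, smul_eq_mul, div_mul_cancel₀ _ h0] at h4
  exact ht₀ h4

theorem IsSchwartzBruhat.comp_linearEquiv {f : N → ℂ} (hf : IsSchwartzBruhat f) (e : M ≃ₗ[F] N) :
    IsSchwartzBruhat fun x => f (e x) := by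
  have := completeSpace_field F
  exact hf.comp_equiv e.toContinuousLinearEquiv.toContinuousAddEquiv

/-! ### Partial Fourier transforms of Schwartz–Bruhat functions. -/

section PartialFourier

variable [MeasurableSpace M] [BorelSpace M]

/-- Compact support of `g` in `x` gives local constancy in the dual variable, and invariance of `g`
under small translations in `x` gives compact support there. -/
theorem isSchwartzBruhat_partialFourier_of_hasCompactOpenNhd (h : HasCompactOpenNhd F)
    {ψ : AddChar F Circle} (hψ : Continuous ψ) (hψ1 : ψ ≠ 1) (b : M →ₗ[F] P →ₗ[F] F)
    (hb : ∀ y, (∀ x, b x y = 0) → y = 0) (ν : HaarMeasure M) {g : M × N → ℂ}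
    (hg : IsSchwartzBruhat g) :
    IsSchwartzBruhat fun p : P × N => ∫ x, g (x, p.2) * (ψ (b x p.1) : ℂ) ∂ν.1 := by
  obtain ⟨h1, h2⟩ := (isSchwartzBruhat_iff_of_hasCompactOpenNhd h).1 hg
  have ht := eventually_translate_of_isLocallyConstant h1 h2
  refine Or.inl ⟨(IsLocallyConstant.iff_eventually_eq _).2 fun p => ?_, ?_⟩
  -- Small `y` pair trivially with all `x` in the compact projection of the support at once.
  · have e1 : ∀ᶠ y : P in 𝓝 0, ∀ x ∈ Prod.fst '' tsupport g, ψ (b x y) = 1 := by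
      refine (h2.isCompact.image continuous_fst).eventually_forall_of_forall_eventually
        fun x _ => ?_
      have hc : Continuous fun z : P × M => b z.2 z.1 :=
        (continuous_bilinear b).comp continuous_swap
      have := hc.tendsto (0, x)
      simp only [map_zero] at this
      exact this.eventually (eventually_addChar_eq_one h hψ)
    have e2 : ∀ᶠ w : N in 𝓝 0, ∀ z, g (z + (0, w)) = g z := by
      have : Filter.Tendsto (fun w : N => ((0 : M), w)) (𝓝 0) (𝓝 0) :=
        (Continuous.prodMk_right (0 : M)).tendsto 0
      exact this.eventually ht
    have hd1 : Filter.Tendsto (fun p' : P × N => p'.1 - p.1) (𝓝 p) (𝓝 0) := by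
      have : Continuous fun p' : P × N => p'.1 - p.1 := by fun_prop
      simpa using this.tendsto p
    have hd2 : Filter.Tendsto (fun p' : P × N => p'.2 - p.2) (𝓝 p) (𝓝 0) := by
      have : Continuous fun p' : P × N => p'.2 - p.2 := by fun_prop
      simpa using this.tendsto p
    filter_upwards [hd1.eventually e1, hd2.eventually e2] with p' hp1 hp2
    refine integral_congr_ae (Filter.Eventually.of_forall fun x => ?_)
    have a1 : g (x, p'.2) = g (x, p.2) := by
      have := hp2 (x, p.2)
      simpa using this
    change g (x, p'.2) * _ = g (x, p.2) * _
    rw [a1]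
    by_cases hx : x ∈ Prod.fst '' tsupport g
    · have := hp1 x hx
      rw [← sub_add_cancel p'.1 p.1, map_add, AddChar.map_add_eq_mul, this, one_mul]
    · have : g (x, p.2) = 0 :=
        image_eq_zero_of_notMem_tsupport fun hx' => hx ⟨_, hx', rfl⟩
      rw [this, zero_mul, zero_mul]
  · have e1 : ∀ᶠ x : M in 𝓝 0, ∀ z, g (z + (x, 0)) = g z := by
      have : Filter.Tendsto (fun x : M => (x, (0 : N))) (𝓝 0) (𝓝 0) :=
        (Continuous.prodMk_left (0 : N)).tendsto 0
      exact this.eventually ht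
    obtain ⟨K, hK, hKU⟩ := exists_isCompact_of_addChar_eq_one hψ1 b hb e1
    refine HasCompactSupport.intro (hK.prod (h2.isCompact.image continuous_snd)) fun p hp => ?_
    rw [Set.mem_prod, not_and_or] at hp
    rcases hp with hp | hp
    · by_contra hne
      refine hp (hKU _ fun x hx => ?_)
      -- Translating the variable by such an `x` multiplies the integral by `ψ (b x p.1)`; a
      -- non-zero integral forces this factor to be `1`.
      have h3 := integral_add_right_eq_self (μ := ν.1)
        (fun x => g (x, p.2) * (ψ (b x p.1) : ℂ)) x
      have h4 : ∀ z, g (z + x, p.2) = g (z, p.2) := fun z => by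
        have := hx (z, p.2)
        simpa using this
      simp only [h4, map_add, LinearMap.add_apply, AddChar.map_add_eq_mul, Circle.coe_mul,
        ← mul_assoc] at h3
      rw [integral_mul_const] at h3
      have h5 := mul_left_cancel₀ hne (h3.trans (mul_one _).symm)
      exact Circle.ext (h5.trans Circle.coe_one.symm)
    · have : ∀ x, g (x, p.2) = 0 := fun x =>
        image_eq_zero_of_notMem_tsupport fun hx' => hp ⟨_, hx', rfl⟩
      simp [this]

/-- In real coordinates the pairing becomes `exp (i β)`, and the real Fourier transform applies. -/
theorem isSchwartzBruhat_partialFourier_of_isRealGroup (h : IsRealGroup F)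
    {ψ : AddChar F Circle} (hψ : Continuous ψ) (hψ1 : ψ ≠ 1) (b : M →ₗ[F] P →ₗ[F] F)
    (hb : ∀ y, (∀ x, b x y = 0) → y = 0) (ν : HaarMeasure M) {g : M × N → ℂ}
    (hg : IsSchwartzBruhat g) :
    IsSchwartzBruhat fun p : P × N => ∫ x, g (x, p.2) * (ψ (b x p.1) : ℂ) ∂ν.1 := by
  obtain ⟨m, ⟨e⟩⟩ := h.of_finiteDimensional (M := M)
  obtain ⟨n, ⟨e'⟩⟩ := h.of_finiteDimensional (M := N)
  obtain ⟨k, ⟨j⟩⟩ := h.of_finiteDimensional (M := P)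
  obtain ⟨G, hG⟩ := (isSchwartzBruhat_iff_of_isRealGroup h (prodContinuousAddEquiv e e')).1 hg
  obtain ⟨β, hβ⟩ := exists_bilinear_of_isRealGroup h hψ b e j
  have hG' : ∀ x w, g (x, w) = G (e x, e' w) := fun x w => hG (x, w)
  -- `Real.fourierChar (-t)` is `exp (-2πi t)`; this normalization turns it into `exp (i β)`.
  let β' := (-(2 * Real.pi)⁻¹) • β
  have hβ' : ∀ v y, β' v y = -(2 * Real.pi)⁻¹ * β v y := fun v y => rfl
  have hker : LinearMap.ker β'.flip.toLinearMap = ⊥ := by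
    refine LinearMap.ker_eq_bot'.2 fun y hy => ?_
    have h0 : ∀ v, β v y = 0 := fun v => by
      have h1 : β' v y = 0 := congrArg (fun l => l v) hy
      rw [hβ'] at h1
      exact (mul_eq_zero.1 h1).resolve_left (by simp [Real.pi_ne_zero])
    obtain ⟨y, rfl⟩ := j.surjective y
    suffices y = 0 by simp [this]
    obtain ⟨t₀, ht₀⟩ := AddChar.ne_one_iff.1 hψ1
    refine hb y fun x => ?_
    by_contra hne
    refine ht₀ ?_
    -- If `b x y ≠ 0`, rescaling `x` makes the pairing equal to `t₀`, while `β` vanishes on it; this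
    -- contradicts `ψ t₀ ≠ 1`.
    have h2 := hβ ((t₀ / b x y) • x) y
    rw [h0, Circle.exp_zero, map_smul, LinearMap.smul_apply, smul_eq_mul,
      div_mul_cancel₀ _ hne] at h2
    exact h2
  obtain ⟨C, -, hC⟩ := LinearMap.exists_antilipschitzWith _ hker
  have hK : ∀ y, ‖y‖ ≤ C * ‖β'.flip y‖ := fun y => by
    simpa using hC.le_mul_norm_sub (x := y) (y := 0)
  have hμ : (ν.1.map e).IsAddHaarMeasure := e.isAddHaarMeasure_map ν.1
  refine (isSchwartzBruhat_iff_of_isRealGroup h (prodContinuousAddEquiv j e')).2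
    ⟨partialFourierSchwartz (ν.1.map e) β' hK G, fun p => ?_⟩
  change _ = ∫ v, (Real.fourierChar (-β' v (j p.1)) : ℂ) • G (v, e' p.2) ∂(ν.1.map e)
  have he := e.toHomeomorph.toMeasurableEquiv.measurableEmbedding.integral_map (μ := ν.1)
    fun v => (Real.fourierChar (-β' v (j p.1)) : ℂ) • G (v, e' p.2)
  refine Eq.trans (integral_congr_ae (Filter.Eventually.of_forall fun x => ?_)) he.symm
  change g (x, p.2) * _ = (Real.fourierChar (-β' (e x) (j p.1)) : ℂ) • G (e x, e' p.2)
  rw [hG', hβ, hβ', smul_eq_mul, mul_comm, Real.fourierChar_apply']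
  congr 3
  have := Real.pi_ne_zero
  field_simp

theorem isSchwartzBruhat_partialFourier (hF : HasCompactOpenNhd F ∨ IsRealGroup F)
    {ψ : AddChar F Circle} (hψ : Continuous ψ) (hψ1 : ψ ≠ 1) (b : M →ₗ[F] P →ₗ[F] F)
    (hb : ∀ y, (∀ x, b x y = 0) → y = 0) (ν : HaarMeasure M) {g : M × N → ℂ}
    (hg : IsSchwartzBruhat g) :
    IsSchwartzBruhat fun p : P × N => ∫ x, g (x, p.2) * (ψ (b x p.1) : ℂ) ∂ν.1 :=
  hF.elim
    (fun h => isSchwartzBruhat_partialFourier_of_hasCompactOpenNhd h hψ hψ1 b hb ν hg)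
    (fun h => isSchwartzBruhat_partialFourier_of_isRealGroup h hψ hψ1 b hb ν hg)

end PartialFourier

end SchwartzBruhat
-- Haar measures under linear isomorphisms, products and shears.
namespace HaarMeasure

variable {F : Type*} [NontriviallyNormedField F] [LocallyCompactSpace F]
variable {M : Type*} [AddCommGroup M] [Module F M] [TopologicalSpace M] [IsTopologicalAddGroup M]
  [ContinuousSMul F M] [T2Space M] [FiniteDimensional F M] [MeasurableSpace M] [BorelSpace M]
variable {N : Type*} [AddCommGroup N] [Module F N] [TopologicalSpace N] [IsTopologicalAddGroup N]
  [ContinuousSMul F N] [T2Space N] [FiniteDimensional F N] [MeasurableSpace N] [BorelSpace N]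
variable {K : Type*} [AddCommGroup K] [Module F K] [TopologicalSpace K] [IsTopologicalAddGroup K]
  [ContinuousSMul F K] [T2Space K] [FiniteDimensional F K] [MeasurableSpace K] [BorelSpace K]
variable {M' : Type*} [AddCommGroup M'] [Module F M'] [TopologicalSpace M']
  [IsTopologicalAddGroup M'] [ContinuousSMul F M'] [T2Space M'] [FiniteDimensional F M']
  [MeasurableSpace M'] [BorelSpace M']
variable {N' : Type*} [AddCommGroup N'] [Module F N'] [TopologicalSpace N']
  [IsTopologicalAddGroup N'] [ContinuousSMul F N'] [T2Space N'] [FiniteDimensional F N']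
  [MeasurableSpace N'] [BorelSpace N']

theorem ext {μ ν : HaarMeasure M} (h : μ.1 = ν.1) : μ = ν := Subtype.ext h

theorem continuous_linearEquiv (e : M ≃ₗ[F] N) : Continuous e := by
  have := completeSpace_field F
  exact e.toContinuousLinearEquiv.continuous

theorem sigmaFinite (F : Type*) [NontriviallyNormedField F] [LocallyCompactSpace F]
    {M : Type*} [AddCommGroup M] [Module F M] [TopologicalSpace M] [IsTopologicalAddGroup M]
    [ContinuousSMul F M] [T2Space M] [FiniteDimensional F M] [MeasurableSpace M] [BorelSpace M]
    (μ : HaarMeasure M) : SigmaFinite μ.1 := by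
  have := polishSpace_of_finiteDimensional F M
  have := locallyCompactSpace_of_finiteDimensional F M
  infer_instance

theorem eq_ratio_smul (F : Type*) [NontriviallyNormedField F] [LocallyCompactSpace F]
    {M : Type*} [AddCommGroup M] [Module F M] [TopologicalSpace M] [IsTopologicalAddGroup M]
    [ContinuousSMul F M] [T2Space M] [FiniteDimensional F M] [MeasurableSpace M] [BorelSpace M]
    (μ ν : HaarMeasure M) : μ.1 = ratio μ ν • ν.1 := by
  have := polishSpace_of_finiteDimensional F M
  have := locallyCompactSpace_of_finiteDimensional F M
  exact Measure.isAddLeftInvariant_eq_smul μ.1 ν.1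

theorem ratio_eq_of_smul (F : Type*) [NontriviallyNormedField F] [LocallyCompactSpace F]
    {M : Type*} [AddCommGroup M] [Module F M] [TopologicalSpace M] [IsTopologicalAddGroup M]
    [ContinuousSMul F M] [T2Space M] [FiniteDimensional F M] [MeasurableSpace M] [BorelSpace M]
    {μ ν κ : HaarMeasure M} {a b : ℝ≥0} (h : μ.1 = a • κ.1) (h' : ν.1 = b • κ.1) :
    ratio μ ν = a / b := by
  have hκ : ratio κ κ = 1 := Measure.addHaarScalarFactor_self κ.1
  have hb : ratio ν κ = b := by rw [ratio_of_eq_smul F M h' κ, hκ, mul_one]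
  have hb0 : b ≠ 0 := hb ▸ ratio_ne_zero ν κ
  have h1 : ratio μ ν = a * ratio κ ν := ratio_of_eq_smul F M h ν
  have h2 : (1 : ℝ≥0) = b * ratio κ ν := by
    rw [← ratio_of_eq_smul F M h' ν]
    exact (Measure.addHaarScalarFactor_self ν.1).symm
  rw [h1, eq_div_iff hb0, mul_assoc, mul_comm _ b, ← h2, mul_one]

theorem integral_map_linearEquiv (e : M ≃ₗ[F] N) (μ : HaarMeasure M) (f : N → ℂ) :
    ∫ y, f y ∂(map e μ).1 = ∫ x, f (e x) ∂μ.1 := by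
  have := completeSpace_field F
  exact e.toContinuousLinearEquiv.toHomeomorph.toMeasurableEquiv.measurableEmbedding.integral_map f

theorem map_smul_of_eq (e : M ≃ₗ[F] N) {μ μ' : HaarMeasure M} {c : ℝ≥0} (h : μ.1 = c • μ'.1) :
    (map e μ).1 = c • (map e μ').1 := by
  change μ.1.map e = c • μ'.1.map e
  rw [h, Measure.map_smul]

theorem prodMap_smul_of_eq (e : (M × N) ≃ₗ[F] K) {μ μ' : HaarMeasure M} {ν ν' : HaarMeasure N}
    {a b : ℝ≥0} (hμ : μ.1 = a • μ'.1) (hν : ν.1 = b • ν'.1) :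
    (prodMap e μ ν).1 = (a * b) • (prodMap e μ' ν').1 := by
  have := sigmaFinite F μ'
  have := sigmaFinite F ν'
  change (μ.1.prod ν.1).map e = (a * b) • (μ'.1.prod ν'.1).map e
  rw [hμ, hν]
  change (((a : ENNReal) • μ'.1).prod ((b : ENNReal) • ν'.1)).map e = _
  rw [Measure.prod_smul_left, Measure.prod_smul_right, smul_smul, Measure.map_smul]
  rw [← ENNReal.coe_mul]
  rfl

theorem prodMap_map (e : (M × N) ≃ₗ[F] K) (f : M' ≃ₗ[F] M) (g : N' ≃ₗ[F] N)
    (μ : HaarMeasure M') (ν : HaarMeasure N') :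
    prodMap e (map f μ) (map g ν) = prodMap ((f.prodCongr g).trans e) μ ν := by
  have := sigmaFinite F μ
  have := sigmaFinite F ν
  have hf := (continuous_linearEquiv f).measurable
  have hg := (continuous_linearEquiv g).measurable
  have := polishSpace_of_finiteDimensional F M
  have := polishSpace_of_finiteDimensional F N
  refine ext ?_
  change ((μ.1.map f).prod (ν.1.map g)).map e = (μ.1.prod ν.1).map (e ∘ Prod.map f g)
  rw [Measure.map_prod_map _ _ hf hg, Measure.map_map (continuous_linearEquiv e).measurable
    (hf.prodMap hg)]

theorem map_prodMap {K' : Type*} [AddCommGroup K'] [Module F K'] [TopologicalSpace K']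
    [IsTopologicalAddGroup K'] [ContinuousSMul F K'] [T2Space K'] [FiniteDimensional F K']
    [MeasurableSpace K'] [BorelSpace K'] (e : (M × N) ≃ₗ[F] K) (f : K ≃ₗ[F] K')
    (μ : HaarMeasure M) (ν : HaarMeasure N) :
    map f (prodMap e μ ν) = prodMap (e.trans f) μ ν := by
  have := polishSpace_of_finiteDimensional F M
  have := polishSpace_of_finiteDimensional F N
  exact ext (Measure.map_map (continuous_linearEquiv f).measurable
    (continuous_linearEquiv e).measurable)

theorem prodMap_swap (e : (M × N) ≃ₗ[F] K) (μ : HaarMeasure M) (ν : HaarMeasure N) :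
    prodMap ((LinearEquiv.prodComm F N M).trans e) ν μ = prodMap e μ ν := by
  have := sigmaFinite F μ
  have := sigmaFinite F ν
  have := polishSpace_of_finiteDimensional F M
  have := polishSpace_of_finiteDimensional F N
  refine ext ?_
  change (ν.1.prod μ.1).map (e ∘ Prod.swap) = (μ.1.prod ν.1).map e
  rw [← Measure.map_map (continuous_linearEquiv e).measurable measurable_swap, Measure.prod_swap]

/-- Two parametrizations of a space by `M × N` that differ by a shear carry products of Haar
measures to the same measure. -/
theorem prodMap_eq_of_shear (e e' : (M × N) ≃ₗ[F] K) (h₁ : ∀ a, e (a, 0) = e' (a, 0))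
    (h₂ : ∀ c, (e'.symm (e (0, c))).2 = c) (μ : HaarMeasure M) (ν : HaarMeasure N) :
    prodMap e μ ν = prodMap e' μ ν := by
  have := sigmaFinite F μ
  have := sigmaFinite F ν
  have := polishSpace_of_finiteDimensional F M
  have := polishSpace_of_finiteDimensional F N
  have := completeSpace_field F
  -- The two hypotheses say that `e'⁻¹ e` is `(a, c) ↦ (a + σ c, c)`.
  let σ : N →ₗ[F] M := LinearMap.fst F M N ∘ₗ e'.symm.toLinearMap ∘ₗ e.toLinearMap ∘ₗ
    LinearMap.inr F M N
  have hσ : ∀ p : M × N, e p = e' (p.1 + σ p.2, p.2) := by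
    intro p
    have h3 : e' (σ p.2, p.2) = e (0, p.2) := by
      have : (σ p.2, p.2) = e'.symm (e (0, p.2)) := Prod.ext rfl (h₂ p.2).symm
      rw [this, LinearEquiv.apply_symm_apply]
    have h4 : p = (p.1, 0) + (0, p.2) := by simp
    have h5 : (p.1 + σ p.2, p.2) = (p.1, 0) + (σ p.2, p.2) := by simp
    conv_lhs => rw [h4]
    rw [h5, map_add, map_add, h₁, h3]
  have hσc : Continuous σ := LinearMap.continuous_of_finiteDimensional _
  -- On each fibre over `c` the shear is a translation. The factors are swapped because a skew
  -- product moves the second one.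
  have hm : MeasurePreserving (fun p : N × M => (p.1, p.2 + σ p.1)) (ν.1.prod μ.1)
      (ν.1.prod μ.1) :=
    (MeasurePreserving.id ν.1).skew_product (g := fun c a => a + σ c)
      (by
        have : Continuous fun p : N × M => p.2 + σ p.1 := by fun_prop
        exact this.measurable)
      (Filter.Eventually.of_forall fun c => map_add_right_eq_self μ.1 (σ c))
  have hm' := (Measure.measurePreserving_swap (μ := ν.1) (ν := μ.1)).comp
    (hm.comp (Measure.measurePreserving_swap (μ := μ.1) (ν := ν.1)))
  refine ext ?_
  change (μ.1.prod ν.1).map e = (μ.1.prod ν.1).map e'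
  conv_rhs => rw [← hm'.map_eq]
  rw [Measure.map_map (continuous_linearEquiv e').measurable hm'.measurable]
  congr 1
  funext p
  exact hσ p

end HaarMeasure

/-! ### Uniqueness and transport of self-dual measures. -/

section SelfDual

variable {F : Type*} [NontriviallyNormedField F] [LocallyCompactSpace F]
variable {M : Type*} [AddCommGroup M] [Module F M] [TopologicalSpace M] [IsTopologicalAddGroup M]
  [ContinuousSMul F M] [T2Space M] [FiniteDimensional F M] [MeasurableSpace M] [BorelSpace M]
variable {N : Type*} [AddCommGroup N] [Module F N] [TopologicalSpace N] [IsTopologicalAddGroup N]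
  [ContinuousSMul F N] [T2Space N] [FiniteDimensional F N] [MeasurableSpace N] [BorelSpace N]

/-- If `μ' = c μ`, the double Fourier transform is scaled by `c²`. A non-zero test function gives
`c² = 1`, and `c ≥ 0`. -/
theorem IsSelfDual.unique {ψ : AddChar F Circle} {B : LinearMap.BilinForm F M}
    {μ μ' : HaarMeasure M} (hμ : IsSelfDual ψ B μ) (hμ' : IsSelfDual ψ B μ')
    (hf : ∃ (f : M → ℂ) (x : M), IsSchwartzBruhat f ∧ f x ≠ 0) : μ' = μ := by
  obtain ⟨f, z, hf, hz⟩ := hf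
  have h := HaarMeasure.eq_ratio_smul F μ' μ
  set c := HaarMeasure.ratio μ' μ
  have h1 := hμ' f hf z
  simp only [h, integral_smul_nnreal_measure, NNReal.smul_def, Complex.real_smul, mul_assoc,
    integral_const_mul] at h1
  rw [hμ f hf z, ← mul_assoc] at h1
  have h3 : (c : ℂ) * c = 1 := mul_right_cancel₀ hz (h1.trans (one_mul _).symm)
  have h4 : c * c = 1 := by exact_mod_cast h3
  have h5 : c = 1 := by
    rw [← sq] at h4
    exact (pow_eq_one_iff_of_nonneg zero_le two_ne_zero).1 h4
  refine HaarMeasure.ext ?_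
  rw [h, h5, one_smul]

theorem IsSelfDual.map {ψ : AddChar F Circle} {B : LinearMap.BilinForm F M}
    {B' : LinearMap.BilinForm F N} {μ : HaarMeasure M} (hμ : IsSelfDual ψ B μ) (e : M ≃ₗ[F] N)
    (he : ∀ x y, B' (e x) (e y) = B x y) : IsSelfDual ψ B' (HaarMeasure.map e μ) := by
  intro f hf z
  obtain ⟨z, rfl⟩ := e.surjective z
  simp only [HaarMeasure.integral_map_linearEquiv, he]
  exact hμ _ (hf.comp_linearEquiv e) z

end SelfDual
-- Isotropic complements, and the quotients attached to `Y ⊕ Y` and the diagonal.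
section Algebra

variable {F : Type*} [Field F] {Z : Type*} [AddCommGroup Z] [Module F Z]

theorem Lagrangian.mem_of_forall {B : LinearMap.BilinForm F Z} (Y : Lagrangian B) {z : Z}
    (h : ∀ y ∈ Y.space, B y z = 0) : z ∈ Y.space := by
  rw [← Y.orthogonal_eq]
  exact h

/-- Every Lagrangian subspace has an isotropic complement. -/
theorem Lagrangian.exists_isCompl_isotropic [CharZero F] [FiniteDimensional F Z]
    {B : LinearMap.BilinForm F Z} (hB : IsSymplectic B) (Y : Lagrangian B) :
    ∃ X : Submodule F Z, IsCompl Y.space X ∧ ∀ x ∈ X, ∀ x' ∈ X, B x x' = 0 := by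
  obtain ⟨X, hX⟩ := Y.space.exists_isCompl
  let π : Z →ₗ[F] Z := X.subtype ∘ₗ X.projectionOnto Y.space hX.symm
  have hπX : ∀ x ∈ X, π x = x := fun x hx =>
    congrArg Subtype.val (Submodule.projectionOnto_apply_left hX.symm ⟨x, hx⟩)
  have hπY : ∀ y ∈ Y.space, π y = 0 := fun y hy =>
    congrArg Subtype.val (Submodule.projectionOnto_apply_right hX.symm ⟨y, hy⟩)
  let D := B.toDual hB.nondegenerate
  -- An arbitrary complement `X` is corrected to the graph `x + T x`. The form `x, z ↦ -B x (π z) /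
  -- 2` vanishes for `z ∈ Y`, so `T` takes values in `Y^⊥ = Y`.
  let T : Z →ₗ[F] Z := D.symm.toLinearMap ∘ₗ ((-(1 / 2) : F) • B.compl₂ π)
  have hT : ∀ x z, B (T x) z = -(1 / 2) * B x (π z) := by
    intro x z
    have : D (T x) = ((-(1 / 2) : F) • B.compl₂ π) x := D.apply_symm_apply _
    have h2 := LinearMap.congr_fun this z
    rw [LinearMap.BilinForm.toDual_def] at h2
    rw [h2]
    simp
  have hTY : ∀ x, T x ∈ Y.space := fun x => Y.mem_of_forall fun y hy => by
    rw [← hB.isAlt.neg_eq, hT, hπY y hy]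
    simp
  refine ⟨X.map (LinearMap.id + T), ⟨?_, ?_⟩, ?_⟩
  · rw [Submodule.disjoint_def]
    rintro _ hz ⟨x, hx, rfl⟩
    have h1 : x + T x ∈ Y.space := hz
    have h2 : x ∈ Y.space := (Submodule.add_mem_iff_left _ (hTY x)).1 h1
    have h3 : x = 0 := (Submodule.disjoint_def.1 hX.disjoint) x h2 hx
    simp [h3]
  · rw [codisjoint_iff, eq_top_iff]
    rintro z -
    have hz : z ∈ Y.space ⊔ X := hX.sup_eq_top ▸ trivial
    obtain ⟨y, hy, x, hx, rfl⟩ := Submodule.mem_sup.1 hz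
    refine Submodule.mem_sup.2 ⟨y - T x, Y.space.sub_mem hy (hTY x), x + T x, ⟨x, hx, rfl⟩, ?_⟩
    abel
  · rintro _ ⟨x, hx, rfl⟩ _ ⟨x', hx', rfl⟩
    change B (x + T x) (x' + T x') = 0
    -- The two cross terms each contribute `-B x x' / 2` and cancel `B x x'`.
    have h1 : B x (T x') = -(1 / 2) * B x x' := by
      rw [← hB.isAlt.neg_eq, hT, hπX x hx, ← hB.isAlt.neg_eq x x']
      ring
    rw [map_add, map_add, LinearMap.add_apply, LinearMap.add_apply, hT, hπX x' hx', h1,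
      Y.isotropic (hTY x) (hTY x')]
    ring

theorem mem_double_sup_diagonal {B : LinearMap.BilinForm F Z} (hB : IsSymplectic B)
    (Y : Lagrangian B) {p : Z × Z} :
    p ∈ Y.double.space ⊔ (diagonal hB).space ↔ p.1 - p.2 ∈ Y.space := by
  constructor
  · intro h
    obtain ⟨a, ⟨ha1, ha2⟩, b, hb, rfl⟩ := Submodule.mem_sup.1 h
    have hb : b.1 = b.2 := hb
    have : (a + b).1 - (a + b).2 = a.1 - a.2 := by simp [hb]
    rw [this]
    exact Y.space.sub_mem ha1 ha2
  · intro h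
    refine Submodule.mem_sup.2 ⟨(p.1 - p.2, 0), ⟨h, Y.space.zero_mem⟩, (p.2, p.2), rfl, ?_⟩
    ext <;> simp

/-- `Z ⧸ Y = Δ / ((Y ⊕ Y) ∩ Δ)`. -/
noncomputable def diagRelEquiv {B : LinearMap.BilinForm F Z} (hB : IsSymplectic B)
    (Y : Lagrangian B) : (Z ⧸ Y.space) ≃ₗ[F] RelQuot Y.double.space (diagonal hB).space :=
  Submodule.Quotient.equiv _ _
    ({ toFun := fun z => ⟨(z, z), rfl⟩
       invFun := fun p => p.1.1
       map_add' := fun _ _ => rfl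
       map_smul' := fun _ _ => rfl
       left_inv := fun _ => rfl
       right_inv := fun p => Subtype.ext (Prod.ext rfl p.2) } :
      Z ≃ₗ[F] (diagonal hB).space) (by
    ext ⟨⟨a, b⟩, h : a = b⟩
    subst h
    constructor
    · rintro ⟨z, hz, hz'⟩
      have : z = a := congrArg (fun p => p.1.1) hz'
      subst this
      exact ⟨hz, hz⟩
    · rintro ⟨h1, -⟩
      exact ⟨a, h1, rfl⟩)

theorem diagRelEquiv_mk {B : LinearMap.BilinForm F Z} (hB : IsSymplectic B)
    (Y : Lagrangian B) (z : Z) : diagRelEquiv hB Y (Submodule.Quotient.mk z) =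
      Submodule.Quotient.mk ⟨(z, z), rfl⟩ := rfl

/-- `Y = (Y ⊕ Y) / ((Y ⊕ Y) ∩ Δ)`, through the first copy. -/
noncomputable def fstRelEquiv {B : LinearMap.BilinForm F Z} (hB : IsSymplectic B)
    (Y : Lagrangian B) : Y.space ≃ₗ[F] RelQuot (diagonal hB).space Y.double.space :=
  LinearEquiv.ofBijective (((diagonal hB).space.submoduleOf Y.double.space).mkQ ∘ₗ
    LinearMap.codRestrict Y.double.space (LinearMap.inl F Z Z ∘ₗ Y.space.subtype)
      fun y => ⟨y.2, Y.space.zero_mem⟩) <| by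
    constructor
    · rw [← LinearMap.ker_eq_bot, LinearMap.ker_eq_bot']
      intro y hy
      exact Subtype.ext ((Submodule.Quotient.mk_eq_zero _).1 hy)
    · intro q
      obtain ⟨⟨⟨a, b⟩, ha, hb⟩, rfl⟩ := Submodule.mkQ_surjective _ q
      refine ⟨⟨a - b, Y.space.sub_mem ha hb⟩, (Submodule.Quotient.eq _).2 ?_⟩
      change a - b - a = 0 - b
      abel

/-- `Z ⧸ Y = (Z ⊕ Z) / (Y ⊕ Y + Δ)`, through the first copy. -/
noncomputable def fstSupEquiv {B : LinearMap.BilinForm F Z} (hB : IsSymplectic B)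
    (Y : Lagrangian B) : (Z ⧸ Y.space) ≃ₗ[F]
      ((Z × Z) ⧸ (Y.double.space ⊔ (diagonal hB).space)) :=
  LinearEquiv.ofBijective (Y.space.mapQ _ (LinearMap.inl F Z Z) fun y hy =>
    (mem_double_sup_diagonal hB Y).2 (by simpa using hy)) <| by
    constructor
    · rw [← LinearMap.ker_eq_bot, LinearMap.ker_eq_bot']
      intro q hq
      obtain ⟨z, rfl⟩ := Submodule.mkQ_surjective _ q
      have h1 := (mem_double_sup_diagonal hB Y).1 ((Submodule.Quotient.mk_eq_zero _).1 hq)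
      exact (Submodule.Quotient.mk_eq_zero _).2 (by simpa using h1)
    · intro q
      obtain ⟨⟨a, b⟩, rfl⟩ := Submodule.mkQ_surjective _ q
      refine ⟨Submodule.Quotient.mk (a - b), (Submodule.Quotient.eq _).2 ?_⟩
      exact (mem_double_sup_diagonal hB Y).2 (by simp)

theorem fstSupEquiv_mk {B : LinearMap.BilinForm F Z} (hB : IsSymplectic B)
    (Y : Lagrangian B) (z : Z) : fstSupEquiv hB Y (Submodule.Quotient.mk z) =
      Submodule.Quotient.mk (z, 0) := rfl

/-- `Y ⊕ Z ⧸ Y = Z`, through a complement of `Y`. -/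
noncomputable def complEquiv {ℓ X : Submodule F Z} (h : IsCompl ℓ X) : (ℓ × (Z ⧸ ℓ)) ≃ₗ[F] Z :=
  ((LinearEquiv.refl F ℓ).prodCongr (Submodule.quotientEquivOfIsCompl ℓ X h)).trans
    (Submodule.prodEquivOfIsCompl ℓ X h)

theorem firstCopyEquiv_apply {B : LinearMap.BilinForm F Z} (hB : IsSymplectic B) (z : Z) :
    firstCopyEquiv hB z = Submodule.Quotient.mk (z, 0) := rfl

end Algebra

/-! ### Half-densities in terms of splittings. -/

section Splitting

variable {F : Type*} [NontriviallyNormedField F] [LocallyCompactSpace F]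
variable {Z : Type*} [AddCommGroup Z] [Module F Z] [TopologicalSpace Z] [IsTopologicalAddGroup Z]
  [ContinuousSMul F Z] [T2Space Z] [FiniteDimensional F Z] [MeasurableSpace Z] [BorelSpace Z]
variable {ψ : AddChar F Circle} {B : LinearMap.BilinForm F Z}

theorem complEquiv_apply {ℓ X : Submodule F Z} (h : IsCompl ℓ X) (p : ℓ × (Z ⧸ ℓ)) :
    complEquiv h p = p.1 + splitting h p.2 := rfl

theorem splitting_mem_compl {ℓ X : Submodule F Z} (h : IsCompl ℓ X) (q : Z ⧸ ℓ) :
    splitting h q ∈ X := Subtype.prop _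

theorem sub_splitting_mem {ℓ X : Submodule F Z} (h : IsCompl ℓ X) (z : Z) :
    z - splitting h (Submodule.Quotient.mk z) ∈ ℓ := by
  rw [← Submodule.Quotient.eq]
  exact (mk_splitting h _).symm

theorem splitting_mk_of_mem {ℓ X : Submodule F Z} (h : IsCompl ℓ X) {x : Z} (hx : x ∈ X) :
    splitting h (Submodule.Quotient.mk x) = x := by
  have h1 := sub_splitting_mem h x
  have h2 := X.sub_mem hx (splitting_mem_compl h (Submodule.Quotient.mk x))
  exact (sub_eq_zero.1 (Submodule.disjoint_def.1 h.disjoint _ h1 h2)).symm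

theorem splitting_add {ℓ X : Submodule F Z} (h : IsCompl ℓ X) (q q' : Z ⧸ ℓ) :
    splitting h (q + q') = splitting h q + splitting h q' := by
  simp [splitting]

theorem splitting_zero {ℓ X : Submodule F Z} (h : IsCompl ℓ X) :
    splitting h (0 : Z ⧸ ℓ) = 0 := by
  simp [splitting]

/-- The function `φ / μ^{1/2}` in terms of its values on a complement. -/
theorem HalfDensity.coeff_eq_splitting (hB : B.IsAlt) (Y : Lagrangian B) {X : Submodule F Z}
    (h : IsCompl Y.space X) (φ : HalfDensity ψ B Y.space) (μ : HaarMeasure (Z ⧸ Y.space)) (z : Z) :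
    φ.coeff μ z = (ψ (B (splitting h (Submodule.Quotient.mk z)) z / 2) : ℂ) *
      toFunction h μ φ (Submodule.Quotient.mk z) := by
  set s := splitting h (Submodule.Quotient.mk z : Z ⧸ Y.space) with hs
  have h1 := φ.coeff_add μ (z - s) (sub_splitting_mem h z) s
  rw [sub_add_cancel, map_sub, hB.self_eq_zero, sub_zero] at h1
  exact h1

theorem splitting_double (Y : Lagrangian B) {X : Submodule F Z}
    (h : IsCompl Y.space X) (p : Z × Z) :
    splitting (isCompl_double Y h) (Submodule.Quotient.mk p) =
      (splitting h (Submodule.Quotient.mk p.1), splitting h (Submodule.Quotient.mk p.2)) := by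
  have := borelSpace_prod F Z
  have hX : (splitting h (Submodule.Quotient.mk p.1), splitting h (Submodule.Quotient.mk p.2)) ∈
      X.prod X := ⟨splitting_mem_compl h _, splitting_mem_compl h _⟩
  rw [← splitting_mk_of_mem (isCompl_double Y h) hX]
  congr 1
  exact (Submodule.Quotient.eq _).2 ⟨sub_splitting_mem h _, sub_splitting_mem h _⟩

theorem quotProdEquiv_symm_mk (Y : Lagrangian B) (p : Z × Z) :
    (quotProdEquiv Y).symm (Submodule.Quotient.mk p) =
      (Submodule.Quotient.mk p.1, Submodule.Quotient.mk p.2) := by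
  rw [LinearEquiv.symm_apply_eq]
  change _ = (Submodule.Quotient.mk (p.1, 0) : (Z × Z) ⧸ Y.double.space) +
    Submodule.Quotient.mk (0, p.2)
  rw [← Submodule.Quotient.mk_add]
  simp

/-- The second summand of `doubleForm` has a minus sign, so its phase is the conjugate of the phase
of `φ₂`. Hence the phases recombine with `Φ₁` and `Φ̄₂`, and the complement disappears. -/
theorem doubling_coeff (hB : B.IsAlt) (Y : Lagrangian B) {X : Submodule F Z}
    (h : IsCompl Y.space X) (dx : HaarMeasure (Z ⧸ Y.space)) (φ₁ φ₂ : HalfDensity ψ B Y.space)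
    [BorelSpace (Z × Z)] (μ : HaarMeasure ((Z × Z) ⧸ Y.double.space)) (p : Z × Z) :
    (doubling hB Y h dx φ₁ φ₂).coeff μ p =
      ((Real.sqrt (HaarMeasure.ratio μ (HaarMeasure.prodMap (quotProdEquiv Y) dx dx)))⁻¹ : ℂ) *
        (φ₁.coeff dx p.1 * star (φ₂.coeff dx p.2)) := by
  rw [φ₁.coeff_eq_splitting hB Y h, φ₂.coeff_eq_splitting hB Y h]
  change _ * ((ψ (doubleForm B (splitting (isCompl_double Y h) (Submodule.Quotient.mk p)) p / 2) :
    ℂ) * _) = _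
  beta_reduce
  rw [quotProdEquiv_symm_mk, splitting_double Y h, doubleForm_apply, sub_div, sub_eq_add_neg,
    AddChar.map_add_eq_mul, AddChar.map_neg_eq_inv, Circle.coe_mul, Circle.coe_inv_eq_conj]
  simp only [star_mul', Complex.star_def]
  ring

end Splitting
-- The constant of the intertwiner.
section Constants

variable {F : Type*} [NontriviallyNormedField F] [LocallyCompactSpace F]
variable {Z : Type*} [AddCommGroup Z] [Module F Z] [TopologicalSpace Z] [IsTopologicalAddGroup Z]
  [ContinuousSMul F Z] [T2Space Z] [FiniteDimensional F Z] [MeasurableSpace Z] [BorelSpace Z]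
variable {ψ : AddChar F Circle} {B : LinearMap.BilinForm F Z}

/-- With `relEquiv_inl`, this is all that has to be known about the chosen splitting: two choices
differ by a shear. -/
theorem factor_relEquiv (ℓ ℓ' : Submodule F Z) {P : Submodule F Z} (hP : ℓ ⊔ ℓ' = P) (c : Z ⧸ P) :
    Submodule.factor (le_sup_left.trans hP.le : ℓ ≤ P) (relEquiv ℓ ℓ' hP (0, c)) = c := by
  have h : relEquiv ℓ ℓ' hP (0, c) = relIncl ℓ ℓ' 0 + relSplit (le_sup_left.trans hP.le) c := rfl
  rw [h, map_zero, zero_add, factor_relSplit]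

theorem relEquiv_inl (ℓ ℓ' : Submodule F Z) {P : Submodule F Z} (hP : ℓ ⊔ ℓ' = P)
    (a : RelQuot ℓ ℓ') : relEquiv ℓ ℓ' hP (a, 0) = relIncl ℓ ℓ' a := by
  have h : relEquiv ℓ ℓ' hP (a, 0) = relIncl ℓ ℓ' a + relSplit (le_sup_left.trans hP.le) 0 := rfl
  rw [h, map_zero, add_zero]

/-- The automorphism `(x, w) ↦ (x + w, x)` of `M × M`. -/
def shearSwap (F M : Type*) [Field F] [AddCommGroup M] [Module F M] : (M × M) ≃ₗ[F] (M × M) where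
  toFun p := (p.1 + p.2, p.1)
  invFun p := (p.2, p.1 - p.2)
  map_add' p q := by ext <;> simp [add_add_add_comm]
  map_smul' c p := by ext <;> simp
  left_inv p := by simp
  right_inv p := by simp

/-- A swap of the two equal factors followed by a shear. -/
theorem prodMap_shearSwap {M K : Type*} [AddCommGroup M] [Module F M] [TopologicalSpace M]
    [IsTopologicalAddGroup M] [ContinuousSMul F M] [T2Space M] [FiniteDimensional F M]
    [MeasurableSpace M] [BorelSpace M] [AddCommGroup K] [Module F K] [TopologicalSpace K]
    [IsTopologicalAddGroup K] [ContinuousSMul F K] [T2Space K] [FiniteDimensional F K]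
    [MeasurableSpace K] [BorelSpace K] (e : (M × M) ≃ₗ[F] K) (μ : HaarMeasure M) :
    HaarMeasure.prodMap ((shearSwap F M).trans e) μ μ = HaarMeasure.prodMap e μ μ := by
  rw [← HaarMeasure.prodMap_swap]
  refine HaarMeasure.prodMap_eq_of_shear _ _ (fun a => ?_) (fun c => ?_) μ μ
  · simp [shearSwap]
  · simp [shearSwap]

theorem mk_complEquiv {ℓ X : Submodule F Z} (h : IsCompl ℓ X) (p : ℓ × (Z ⧸ ℓ)) :
    (Submodule.Quotient.mk (complEquiv h p) : Z ⧸ ℓ) = p.2 := by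
  rw [complEquiv_apply, Submodule.Quotient.mk_add, mk_splitting,
    (Submodule.Quotient.mk_eq_zero ℓ).2 p.1.2, zero_add]

variable [BorelSpace (Z × Z)]

/-- Up to a shear, the extension of `Z / Y` (first copy) by `Z / Y` (diagonal) is `(x, w) ↦ (x + w,
x)`, which preserves `d × d`. -/
theorem extMeasure_double_diagonal (hB : IsSymplectic B) (Y : Lagrangian B)
    (d : HaarMeasure (Z ⧸ Y.space)) :
    extMeasure Y.double.space (diagonal hB).space rfl (HaarMeasure.map (diagRelEquiv hB Y) d)
      (HaarMeasure.map (fstSupEquiv hB Y) d) = HaarMeasure.prodMap (quotProdEquiv Y) d d := by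
  rw [← prodMap_shearSwap (quotProdEquiv Y) d]
  unfold extMeasure
  rw [HaarMeasure.prodMap_map]
  refine HaarMeasure.prodMap_eq_of_shear _ _ (fun a => ?_) (fun c => ?_) d d
  · obtain ⟨z, rfl⟩ := Submodule.Quotient.mk_surjective _ a
    change relEquiv _ _ rfl (diagRelEquiv hB Y (Submodule.Quotient.mk z), fstSupEquiv hB Y 0) =
      quotProdEquiv Y (shearSwap F _ (Submodule.Quotient.mk z, 0))
    rw [map_zero, relEquiv_inl, diagRelEquiv_mk, ← LinearEquiv.symm_apply_eq]
    change (quotProdEquiv Y).symm (Submodule.Quotient.mk (z, z)) = _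
    rw [quotProdEquiv_symm_mk]
    simp [shearSwap]
  · have h1 := factor_relEquiv Y.double.space (diagonal hB).space rfl (fstSupEquiv hB Y c)
    change ((shearSwap F _).symm ((quotProdEquiv Y).symm (relEquiv _ _ rfl
      (diagRelEquiv hB Y 0, fstSupEquiv hB Y c)))).2 = c
    rw [map_zero]
    obtain ⟨⟨a, b⟩, hab⟩ := Submodule.Quotient.mk_surjective _
      (relEquiv Y.double.space (diagonal hB).space rfl (0, fstSupEquiv hB Y c))
    rw [← hab] at h1 ⊢
    rw [quotProdEquiv_symm_mk]
    change (Submodule.Quotient.mk a - Submodule.Quotient.mk b : Z ⧸ Y.space) = c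
    rw [← Submodule.Quotient.mk_sub]
    apply (fstSupEquiv hB Y).injective
    rw [fstSupEquiv_mk, ← h1]
    refine (Submodule.Quotient.eq _).2 ((mem_double_sup_diagonal hB Y).2 ?_)
    simp

/-- Through the first copy, `(Z ⊕ Z) / Δ` is `Z`, and the extension is `Y ⊆ Z` with quotient `Z /
Y`. -/
theorem extMeasure_diagonal_double (hB : IsSymplectic B) (Y : Lagrangian B) {X : Submodule F Z}
    (h : IsCompl Y.space X) (d : HaarMeasure (Z ⧸ Y.space)) (η : HaarMeasure Y.space)
    (hP : (diagonal hB).space ⊔ Y.double.space = Y.double.space ⊔ (diagonal hB).space) :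
    extMeasure (diagonal hB).space Y.double.space hP (HaarMeasure.map (fstRelEquiv hB Y) η)
      (HaarMeasure.map (fstSupEquiv hB Y) d) =
      HaarMeasure.map (firstCopyEquiv hB) (HaarMeasure.prodMap (complEquiv h) η d) := by
  rw [HaarMeasure.map_prodMap]
  unfold extMeasure
  rw [HaarMeasure.prodMap_map]
  refine HaarMeasure.prodMap_eq_of_shear _ _ (fun a => ?_) (fun c => ?_) η d
  · change relEquiv _ _ hP (fstRelEquiv hB Y a, fstSupEquiv hB Y 0) =
      firstCopyEquiv hB (complEquiv h (a, 0))
    rw [map_zero, relEquiv_inl, complEquiv_apply, splitting_zero, add_zero]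
    rfl
  · have h1 := factor_relEquiv (diagonal hB).space Y.double.space hP (fstSupEquiv hB Y c)
    change ((complEquiv h).symm ((firstCopyEquiv hB).symm (relEquiv _ _ hP
      (fstRelEquiv hB Y 0, fstSupEquiv hB Y c)))).2 = c
    rw [map_zero]
    obtain ⟨z, hz⟩ := (firstCopyEquiv hB).surjective
      (relEquiv (diagonal hB).space Y.double.space hP (0, fstSupEquiv hB Y c))
    rw [← hz] at h1 ⊢
    obtain ⟨p, rfl⟩ := (complEquiv h).surjective z
    rw [LinearEquiv.symm_apply_apply, LinearEquiv.symm_apply_apply, ← mk_complEquiv h p]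
    apply (fstSupEquiv hB Y).injective
    rw [← h1]
    rfl

/-- `Y ⊕ Z ⧸ Y = (Y ⊕ Y + Δ) / ((Y ⊕ Y) ∩ Δ)`. -/
noncomputable def subQuotComplEquiv (hB : IsSymplectic B) (Y : Lagrangian B) :
    (Y.space × (Z ⧸ Y.space)) ≃ₗ[F] SubQuot Y.double.space (diagonal hB).space :=
  ((fstRelEquiv hB Y).prodCongr (diagRelEquiv hB Y)).trans
    (subQuotEquiv Y.double.space (diagonal hB).space)

/-- The class of `(y + x, x)` corresponds to `y + x`. The forms differ by the contribution `B x x'`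
of the second copy, which vanishes because `X` is isotropic. -/
theorem complEquiv_isometry (hB : IsSymplectic B) (Y : Lagrangian B) {X : Submodule F Z}
    (h : IsCompl Y.space X) (hX : ∀ x ∈ X, ∀ x' ∈ X, B x x' = 0)
    (p p' : Y.space × (Z ⧸ Y.space)) :
    B (complEquiv h p) (complEquiv h p') =
      subQuotForm Y.double (diagonal hB) (subQuotComplEquiv hB Y p)
        (subQuotComplEquiv hB Y p') := by
  have key : ∀ p : Y.space × (Z ⧸ Y.space), subQuotComplEquiv hB Y p = Submodule.Quotient.mk
      ((⟨((p.1 : Z), 0) + (splitting h p.2, splitting h p.2), Submodule.add_mem_sup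
        ⟨p.1.2, Y.space.zero_mem⟩ rfl⟩ :
        ↥(Y.double.space ⊔ (diagonal hB).space))) := by
    rintro ⟨y, q⟩
    conv_lhs => rw [← mk_splitting h q]
    rfl
  rw [key, key, subQuotForm_mk, doubleForm_apply, complEquiv_apply, complEquiv_apply]
  simp [hX _ (splitting_mem_compl h p.2) _ (splitting_mem_compl h p'.2)]

/-- Let `u`, `t`, `r` measure `ν₁`, `ν₂`, `ρ` against the images of `η`, `d`, `d`, and let `μ = c ν₁
ν₂`. The isometry above carries `μ` to `dz`, so `dz = c u t` times the measure `κ` built from `η`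
and `d`; the product is then `(c t / r)^(-1/2) c^(1/2) (t r)^(-1/2) t = 1`. -/
theorem intertwiner_constant_eq_one (hB : IsSymplectic B) (Y : Lagrangian B) {X : Submodule F Z}
    (h : IsCompl Y.space X) (hX : ∀ x ∈ X, ∀ x' ∈ X, B x x' = 0)
    (hf : ∃ (f : Z → ℂ) (x : Z), IsSchwartzBruhat f ∧ f x ≠ 0)
    {dz : HaarMeasure Z} (hdz : IsSelfDual ψ B dz)
    {μ : HaarMeasure (SubQuot Y.double.space (diagonal hB).space)}
    (hμ : IsSelfDual ψ (subQuotForm Y.double (diagonal hB)) μ)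
    (d : HaarMeasure (Z ⧸ Y.space))
    (ν₁ : HaarMeasure (RelQuot (diagonal hB).space Y.double.space))
    (ν₂ : HaarMeasure (RelQuot Y.double.space (diagonal hB).space))
    (ρ : HaarMeasure ((Z × Z) ⧸ (Y.double.space ⊔ (diagonal hB).space)))
    (hP : (diagonal hB).space ⊔ Y.double.space = Y.double.space ⊔ (diagonal hB).space) :
    (Real.sqrt (HaarMeasure.ratio (HaarMeasure.map (firstCopyEquiv hB) dz)
      (extMeasure (diagonal hB).space Y.double.space hP ν₁ ρ)))⁻¹ *
    (Real.sqrt (HaarMeasure.ratio μ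
      (HaarMeasure.prodMap (subQuotEquiv Y.double.space (diagonal hB).space) ν₁ ν₂)) *
    ((Real.sqrt (HaarMeasure.ratio (extMeasure Y.double.space (diagonal hB).space rfl ν₂ ρ)
      (HaarMeasure.prodMap (quotProdEquiv Y) d d)))⁻¹ *
      (HaarMeasure.ratio ν₂ (HaarMeasure.map (diagRelEquiv hB Y) d) : ℝ))) = 1 := by
  let η : HaarMeasure Y.space := HaarMeasure.some F _
  let κ := HaarMeasure.prodMap (complEquiv h) η d
  obtain ⟨u, hu⟩ : ∃ u, u = HaarMeasure.ratio ν₁ (HaarMeasure.map (fstRelEquiv hB Y) η) :=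
    ⟨_, rfl⟩
  obtain ⟨t, ht⟩ : ∃ t, t = HaarMeasure.ratio ν₂ (HaarMeasure.map (diagRelEquiv hB Y) d) :=
    ⟨_, rfl⟩
  obtain ⟨r, hr⟩ : ∃ r, r = HaarMeasure.ratio ρ (HaarMeasure.map (fstSupEquiv hB Y) d) :=
    ⟨_, rfl⟩
  obtain ⟨c, hc⟩ : ∃ c, c = HaarMeasure.ratio μ
      (HaarMeasure.prodMap (subQuotEquiv Y.double.space (diagonal hB).space) ν₁ ν₂) := ⟨_, rfl⟩
  have hu0 : u ≠ 0 := hu ▸ HaarMeasure.ratio_ne_zero _ _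
  have ht0 : t ≠ 0 := ht ▸ HaarMeasure.ratio_ne_zero _ _
  have hr0 : r ≠ 0 := hr ▸ HaarMeasure.ratio_ne_zero _ _
  have hc0 : c ≠ 0 := hc ▸ HaarMeasure.ratio_ne_zero _ _
  have hν₁ : ν₁.1 = u • (HaarMeasure.map (fstRelEquiv hB Y) η).1 :=
    hu ▸ HaarMeasure.eq_ratio_smul F _ _
  have hν₂ : ν₂.1 = t • (HaarMeasure.map (diagRelEquiv hB Y) d).1 :=
    ht ▸ HaarMeasure.eq_ratio_smul F _ _
  have hρ : ρ.1 = r • (HaarMeasure.map (fstSupEquiv hB Y) d).1 :=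
    hr ▸ HaarMeasure.eq_ratio_smul F _ _
  have hμc : μ.1 = c • (HaarMeasure.prodMap
      (subQuotEquiv Y.double.space (diagonal hB).space) ν₁ ν₂).1 :=
    hc ▸ HaarMeasure.eq_ratio_smul F _ _
  have m1 : (extMeasure Y.double.space (diagonal hB).space rfl ν₂ ρ).1 =
      (t * r) • (HaarMeasure.prodMap (quotProdEquiv Y) d d).1 := by
    rw [← extMeasure_double_diagonal hB Y d]
    exact HaarMeasure.prodMap_smul_of_eq _ hν₂ hρ
  have m2 : (extMeasure (diagonal hB).space Y.double.space hP ν₁ ρ).1 =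
      (u * r) • (HaarMeasure.map (firstCopyEquiv hB) κ).1 := by
    rw [← extMeasure_diagonal_double hB Y h d η hP]
    exact HaarMeasure.prodMap_smul_of_eq _ hν₁ hρ
  have m3 : μ.1 = (c * (u * t)) • (HaarMeasure.prodMap (subQuotComplEquiv hB Y) η d).1 := by
    rw [hμc, HaarMeasure.prodMap_smul_of_eq _ hν₁ hν₂, HaarMeasure.prodMap_map, smul_smul]
    rfl
  -- The only use of self-duality: both measures are self-dual on `Z` for `B`.
  have hθ : dz = HaarMeasure.map ((subQuotComplEquiv hB Y).symm.trans (complEquiv h)) μ := by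
    refine IsSelfDual.unique (IsSelfDual.map hμ _ fun x y => ?_) hdz hf
    obtain ⟨p, rfl⟩ := (subQuotComplEquiv hB Y).surjective x
    obtain ⟨p', rfl⟩ := (subQuotComplEquiv hB Y).surjective y
    rw [← complEquiv_isometry hB Y h hX]
    simp
  have m4 : dz.1 = (c * (u * t)) • κ.1 := by
    rw [hθ, HaarMeasure.map_smul_of_eq _ m3, HaarMeasure.map_prodMap]
    congr 3
    ext p
    simp
  have e1 := HaarMeasure.ratio_eq_of_smul F (HaarMeasure.map_smul_of_eq (firstCopyEquiv hB) m4) m2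
  have e2 : HaarMeasure.ratio (extMeasure Y.double.space (diagonal hB).space rfl ν₂ ρ)
      (HaarMeasure.prodMap (quotProdEquiv Y) d d) = t * r := by
    rw [HaarMeasure.ratio_eq_of_smul F m1 (one_smul _ _).symm, div_one]
  rw [e1, e2, ← hc, ← ht]
  have e3 : c * (u * t) / (u * r) = c * t / r := by field_simp
  rw [e3]
  have hc' : 0 < (c : ℝ) := by positivity
  have ht' : 0 < (t : ℝ) := by positivity
  have hr' : 0 < (r : ℝ) := by positivity
  push_cast
  rw [Real.sqrt_div (by positivity), Real.sqrt_mul hc'.le, Real.sqrt_mul ht'.le]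
  have h1 : Real.sqrt t * Real.sqrt t = t := Real.mul_self_sqrt ht'.le
  have h2 : Real.sqrt c ≠ 0 := by positivity
  have h3 : Real.sqrt t ≠ 0 := by positivity
  have h4 : Real.sqrt r ≠ 0 := by positivity
  field_simp
  rw [sq, h1]

end Constants
-- The diagonal model as an integral over `Z / Y`, and its regularity.
section Main

variable {F : Type*} [NontriviallyNormedField F] [LocallyCompactSpace F]
variable {Z : Type*} [AddCommGroup Z] [Module F Z] [TopologicalSpace Z] [IsTopologicalAddGroup Z]
  [ContinuousSMul F Z] [T2Space Z] [FiniteDimensional F Z] [MeasurableSpace Z] [BorelSpace Z]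
variable {ψ : AddChar F Circle} {B : LinearMap.BilinForm F Z}

theorem coe_mul_integral_ratio (F : Type*) [NontriviallyNormedField F] [LocallyCompactSpace F]
    {M : Type*} [AddCommGroup M] [Module F M] [TopologicalSpace M] [IsTopologicalAddGroup M]
    [ContinuousSMul F M] [T2Space M] [FiniteDimensional F M] [MeasurableSpace M] [BorelSpace M]
    (μ ν : HaarMeasure M) (f : M → ℂ) :
    ∫ x, f x ∂μ.1 = ((HaarMeasure.ratio μ ν : ℝ) : ℂ) * ∫ x, f x ∂ν.1 := by
  conv_lhs => rw [HaarMeasure.eq_ratio_smul F μ ν]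
  rw [integral_smul_nnreal_measure, NNReal.smul_def, Complex.real_smul]

/-- The hermitian pairing in terms of the functions on a complement. -/
theorem HalfDensity.inner_eq_integral (Y : Lagrangian B) {X : Submodule F Z}
    (h : IsCompl Y.space X) (d : HaarMeasure (Z ⧸ Y.space)) (φ₁ φ₂ : HalfDensity ψ B Y.space) :
    φ₁.inner φ₂ = ∫ q, toFunction h d φ₁ q * star (toFunction h d φ₂ q) ∂d.1 := by
  rw [coe_mul_integral_ratio F d (HaarMeasure.some F (Z ⧸ Y.space)), ← integral_const_mul]
  set a := HaarMeasure.ratio d (HaarMeasure.some F (Z ⧸ Y.space)) with ha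
  have hd := HaarMeasure.eq_ratio_smul F d (HaarMeasure.some F (Z ⧸ Y.space))
  refine integral_congr_ae (Filter.Eventually.of_forall fun q => ?_)
  have hq : rep q - splitting h q ∈ Y.space := by
    have := sub_splitting_mem h (rep q)
    rwa [mk_rep] at this
  obtain ⟨l, hl, hr⟩ : ∃ l ∈ Y.space, rep q = l + splitting h q :=
    ⟨_, hq, (sub_add_cancel _ _).symm⟩
  have h1 : ∀ φ : HalfDensity ψ B Y.space, φ.coeff (HaarMeasure.some F (Z ⧸ Y.space)) (rep q) =
      (ψ (B (splitting h q) l / 2) : ℂ) * ((Real.sqrt a : ℂ) * toFunction h d φ q) := fun φ => by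
    rw [hr, φ.coeff_add _ l hl, φ.coeff_smul a _ d hd]
    rfl
  simp only [h1, star_mul', Complex.star_def, Complex.conj_ofReal]
  -- The phases are unimodular and cancel; the two factors `√a` combine into the ratio of the
  -- measures.
  have h2 : (ψ (B (splitting h q) l / 2) : ℂ) *
      (starRingEnd ℂ) (ψ (B (splitting h q) l / 2) : ℂ) = 1 := by
    rw [← Circle.coe_inv_eq_conj, ← Circle.coe_mul, mul_inv_cancel, Circle.coe_one]
  have h3 : (Real.sqrt a : ℂ) * Real.sqrt a = ((a : ℝ) : ℂ) := by
    rw [← Complex.ofReal_mul, Real.mul_self_sqrt a.coe_nonneg]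
  linear_combination (Real.sqrt a : ℂ) * Real.sqrt a * toFunction h d φ₁ q *
    (starRingEnd ℂ) (toFunction h d φ₂ q) * h2 +
    toFunction h d φ₁ q * (starRingEnd ℂ) (toFunction h d φ₂ q) * h3

/-- The function on `Z` attached to the image of `φ₁ ⊗ φ̄₂` in the diagonal model, up to the
constant that comes from the Haar measures. -/
theorem exists_diagonalModel_eq_integral (hB : IsSymplectic B) (dz : HaarMeasure Z)
    (Y : Lagrangian B) (μ : HaarMeasure (SubQuot Y.double.space (diagonal hB).space))
    {X₀ : Submodule F Z} (h₀ : IsCompl Y.space X₀) (d : HaarMeasure (Z ⧸ Y.space))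
    (φ₁ φ₂ : HalfDensity ψ B Y.space) {X : Submodule F Z} (h : IsCompl Y.space X)
    (hX : ∀ x ∈ X, ∀ x' ∈ X, B x x' = 0) :
    ∃ K : ℂ, ((∃ (f : Z → ℂ) (x : Z), IsSchwartzBruhat f ∧ f x ≠ 0) → IsSelfDual ψ B dz →
      IsSelfDual ψ (subQuotForm Y.double (diagonal hB)) μ → K = 1) ∧
      ∀ z, diagonalModel hB dz (toDiagonal hB Y μ (doubling hB.isAlt Y h₀ d φ₁ φ₂))
        (firstCopyEquiv hB z) =
      K * ∫ q, φ₁.coeff d (splitting h q + z) * star (φ₂.coeff d (splitting h q)) *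
        (ψ (B (splitting h q) z / 2) : ℂ) ∂d.1 := by
  have hZ := borelSpace_prod F Z
  let ν₁ : HaarMeasure (RelQuot (diagonal hB).space Y.double.space) := HaarMeasure.some F _
  let ν₂ : HaarMeasure (RelQuot Y.double.space (diagonal hB).space) := HaarMeasure.some F _
  let ρ : HaarMeasure ((Z × Z) ⧸ (Y.double.space ⊔ (diagonal hB).space)) := HaarMeasure.some F _
  -- The witness for `K` is the product in `intertwiner_constant_eq_one`. It is kept conditional
  -- because uniqueness of self-dual measures needs a test function, whereas the integral formula
  -- does not.
  refine ⟨_, fun hf hdz hμ => congrArg Complex.ofReal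
    (intertwiner_constant_eq_one hB Y h hX hf hdz hμ d ν₁ ν₂ ρ (sup_comm _ _)), fun z => ?_⟩
  have hs : splitting (isCompl_firstCopy hB) (firstCopyEquiv hB z) = (z, 0) := by
    rw [firstCopyEquiv_apply]
    exact splitting_mk_of_mem (isCompl_firstCopy hB) ⟨trivial, rfl⟩
  let μ₁ := extMeasure Y.double.space (diagonal hB).space rfl ν₂ ρ
  change ((Real.sqrt (HaarMeasure.ratio (HaarMeasure.map (firstCopyEquiv hB) dz)
      (extMeasure (diagonal hB).space Y.double.space (sup_comm _ _) ν₁ ρ)))⁻¹ : ℂ) *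
    ((Real.sqrt (HaarMeasure.ratio μ
      (HaarMeasure.prodMap (subQuotEquiv Y.double.space (diagonal hB).space) ν₁ ν₂)) : ℂ) *
    ∫ q, (doubling hB.isAlt Y h₀ d φ₁ φ₂).coeff μ₁
      (((rep q : (diagonal hB).space) : Z × Z) + splitting (isCompl_firstCopy hB) (firstCopyEquiv hB z)) *
      (ψ (doubleForm B ((rep q : (diagonal hB).space) : Z × Z)
        (splitting (isCompl_firstCopy hB) (firstCopyEquiv hB z)) / 2) : ℂ) ∂ν₂.1) = _
  rw [hs, coe_mul_integral_ratio F ν₂ (HaarMeasure.map (diagRelEquiv hB Y) d),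
    HaarMeasure.integral_map_linearEquiv]
  have hint : ∀ q : Z ⧸ Y.space, (doubling hB.isAlt Y h₀ d φ₁ φ₂).coeff μ₁
      (((rep (diagRelEquiv hB Y q) : (diagonal hB).space) : Z × Z) + (z, 0)) *
      (ψ (doubleForm B ((rep (diagRelEquiv hB Y q) : (diagonal hB).space) : Z × Z) (z, 0) / 2) :
        ℂ) =
      ((Real.sqrt (HaarMeasure.ratio μ₁ (HaarMeasure.prodMap (quotProdEquiv Y) d d)))⁻¹ : ℂ) *
      (φ₁.coeff d (splitting h q + z) * star (φ₂.coeff d (splitting h q)) *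
        (ψ (B (splitting h q) z / 2) : ℂ)) := by
    intro q
    have hmem : ((splitting h q, splitting h q) : Z × Z) ∈ (diagonal hB).space := rfl
    have hdiff : ((rep (diagRelEquiv hB Y q) : (diagonal hB).space) : Z × Z) -
        (splitting h q, splitting h q) ∈ Y.double.space := by
      have h1 : (Submodule.Quotient.mk (rep (diagRelEquiv hB Y q)) :
          RelQuot Y.double.space (diagonal hB).space) = Submodule.Quotient.mk ⟨_, hmem⟩ := by
        rw [mk_rep]
        conv_lhs => rw [← mk_splitting h q]
        rfl
      exact (Submodule.Quotient.eq (Y.double.space.submoduleOf (diagonal hB).space)).1 h1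
    -- The arbitrary representative in `Δ` may be replaced by `(splitting h q, splitting h q)`.
    rw [integrand_invariant (doubleForm_isAlt hB.isAlt) Y.double (diagonal hB) _ μ₁ hmem
      (Subtype.prop _) hdiff (z, 0), doubling_coeff]
    simp only [Prod.mk_add_mk, add_zero, doubleForm_apply, map_zero, sub_zero]
    ring
  simp only [hint, integral_const_mul]
  push_cast
  ring

/-- A change of complement multiplies the function by a quadratic phase, a change of Haar measure by
a constant; so smoothness for one choice gives it for all. -/
theorem isSchwartzBruhat_toFunction (hF : HasCompactOpenNhd F ∨ IsRealGroup F)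
    (hψ : Continuous ψ) (hB : B.IsAlt) (Y : Lagrangian B) {X : Submodule F Z}
    (h : IsCompl Y.space X) (d : HaarMeasure (Z ⧸ Y.space)) {φ : HalfDensity ψ B Y.space}
    (hφ : φ.IsSmooth) : IsSchwartzBruhat (toFunction h d φ) := by
  obtain ⟨X', h', d', hφ⟩ := hφ
  let s : Z ⧸ Y.space →ₗ[F] Z :=
    X.subtype ∘ₗ (Submodule.quotientEquivOfIsCompl Y.space X h).toLinearMap
  let s' : Z ⧸ Y.space →ₗ[F] Z :=
    X'.subtype ∘ₗ (Submodule.quotientEquivOfIsCompl Y.space X' h').toLinearMap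
  have h1 := (hφ.mul_chirp hF hψ ((2⁻¹ : F) • B.compl₁₂ s' s)).const_mul
    (Real.sqrt (HaarMeasure.ratio d' d) : ℂ)
  convert h1 using 2 with q
  change φ.coeff d (splitting h q) = _
  rw [φ.coeff_smul _ d d' (HaarMeasure.eq_ratio_smul F d' d),
    φ.coeff_eq_splitting hB Y h' d', mk_splitting]
  congr 4
  change _ = 2⁻¹ * B (splitting h' q) (splitting h q)
  rw [inv_mul_eq_div]

/-- Shifting `q` by half of `p.2` makes the arguments symmetric. The phase from moving `y` out of
`φ₁` and the phase of the intertwiner then add up to `B (splitting h q) y`; the pairing with the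
`X`-part of the point vanishes by isotropy. -/
theorem integral_translate_eq_partialFourier [CharZero F] (Y : Lagrangian B)
    {X : Submodule F Z} (h : IsCompl Y.space X) (hX : ∀ x ∈ X, ∀ x' ∈ X, B x x' = 0)
    (d : HaarMeasure (Z ⧸ Y.space)) (φ₁ φ₂ : HalfDensity ψ B Y.space)
    (p : Y.space × (Z ⧸ Y.space)) :
    ∫ q, φ₁.coeff d (splitting h q + complEquiv h p) * star (φ₂.coeff d (splitting h q)) *
        (ψ (B (splitting h q) (complEquiv h p) / 2) : ℂ) ∂d.1 =
      ∫ q, (toFunction h d φ₁ (q + (2⁻¹ : F) • p.2) *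
        star (toFunction h d φ₂ (q - (2⁻¹ : F) • p.2))) * (ψ (B (splitting h q) p.1) : ℂ) ∂d.1 := by
  obtain ⟨y, w⟩ := p
  set v := (2⁻¹ : F) • w with hv
  have hw : w = v + v := by
    rw [hv, ← add_smul, ← two_mul, mul_inv_cancel₀ two_ne_zero, one_smul]
  rw [← integral_sub_right_eq_self _ v]
  refine integral_congr_ae (Filter.Eventually.of_forall fun q => ?_)
  have e1 : splitting h (q - v) + complEquiv h (y, w) = y + splitting h (q + v) := by
    rw [complEquiv_apply, add_left_comm, ← splitting_add]
    congr 2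
    rw [hw, sub_add_add_cancel]
  have e2 : B (splitting h (q - v)) (complEquiv h (y, w)) = B (splitting h (q - v)) y := by
    rw [complEquiv_apply, map_add, hX _ (splitting_mem_compl h _) _ (splitting_mem_compl h _),
      add_zero]
  have e3 : B (splitting h (q + v)) y / 2 + B (splitting h (q - v)) y / 2 =
      B (splitting h q) y := by
    rw [← add_div, ← LinearMap.add_apply, ← map_add, ← splitting_add, add_add_sub_cancel,
      splitting_add, map_add, LinearMap.add_apply, add_self_div_two]
  change φ₁.coeff d (splitting h (q - v) + complEquiv h (y, w)) *
    star (φ₂.coeff d (splitting h (q - v))) *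
    (ψ (B (splitting h (q - v)) (complEquiv h (y, w)) / 2) : ℂ) =
    φ₁.coeff d (splitting h (q + v)) * star (φ₂.coeff d (splitting h (q - v))) *
    (ψ (B (splitting h q) y) : ℂ)
  rw [e1, e2, φ₁.coeff_add d y y.2, ← e3, AddChar.map_add_eq_mul, Circle.coe_mul]
  ring

theorem isSchwartzBruhat_integral_translate [CharZero F]
    (hF : HasCompactOpenNhd F ∨ IsRealGroup F)
    (hψ : Continuous ψ) (hψ1 : ψ ≠ 1) (hB : IsSymplectic B) (Y : Lagrangian B)
    {X : Submodule F Z} (h : IsCompl Y.space X) (hX : ∀ x ∈ X, ∀ x' ∈ X, B x x' = 0)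
    (d : HaarMeasure (Z ⧸ Y.space)) {φ₁ φ₂ : HalfDensity ψ B Y.space} (h₁ : φ₁.IsSmooth)
    (h₂ : φ₂.IsSmooth) :
    IsSchwartzBruhat fun z => ∫ q, φ₁.coeff d (splitting h q + z) *
      star (φ₂.coeff d (splitting h q)) * (ψ (B (splitting h q) z / 2) : ℂ) ∂d.1 := by
  let s : Z ⧸ Y.space →ₗ[F] Z :=
    X.subtype ∘ₗ (Submodule.quotientEquivOfIsCompl Y.space X h).toLinearMap
  let b : Z ⧸ Y.space →ₗ[F] Y.space →ₗ[F] F := B.compl₁₂ s Y.space.subtype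
  -- A vector of `Y` orthogonal to `X` is orthogonal to `Y + X = Z`.
  have hb : ∀ y, (∀ q, b q y = 0) → y = 0 := by
    intro y hy
    refine Subtype.ext (hB.nondegenerate.2 _ fun z => ?_)
    obtain ⟨p, rfl⟩ := (complEquiv h).surjective z
    rw [complEquiv_apply, map_add, LinearMap.add_apply, Y.isotropic p.1.2 y.2, zero_add]
    exact hy p.2
  -- The substitution `(q, w) ↦ (q + w/2, q - w/2)` in `Φ₁ ⊗ Φ̄₂`.
  let T : ((Z ⧸ Y.space) × (Z ⧸ Y.space)) ≃ₗ[F] ((Z ⧸ Y.space) × (Z ⧸ Y.space)) :=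
    { toFun := fun p => (p.1 + (2⁻¹ : F) • p.2, p.1 - (2⁻¹ : F) • p.2)
      invFun := fun p => ((2⁻¹ : F) • (p.1 + p.2), p.1 - p.2)
      map_add' := fun p q => by
        ext
        · simp [add_add_add_comm]
        · simp [add_sub_add_comm]
      map_smul' := fun c p => by
        ext
        · simp [smul_comm c (2⁻¹ : F)]
        · simp [smul_sub, smul_comm c (2⁻¹ : F)]
      left_inv := fun p => by
        ext
        · simp only [add_add_sub_cancel]
          rw [← two_smul F p.1, smul_smul, inv_mul_cancel₀ two_ne_zero, one_smul]
        · simp only [add_sub_sub_cancel, add_sub_sub_cancel]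
          module
      right_inv := fun p => by
        ext
        · simp only
          module
        · simp only
          module }
  have ht := ((isSchwartzBruhat_toFunction hF hψ hB.isAlt Y h d h₁).tensor hF
    (isSchwartzBruhat_toFunction hF hψ hB.isAlt Y h d h₂).star).comp_linearEquiv T
  have hpf := isSchwartzBruhat_partialFourier hF hψ hψ1 b hb d ht
  have hpf' := hpf.comp_linearEquiv (complEquiv h).symm
  convert hpf' using 2 with z
  obtain ⟨p, rfl⟩ := (complEquiv h).surjective z
  rw [integral_translate_eq_partialFourier Y h hX, LinearEquiv.symm_apply_apply]
  rfl

theorem Lagrangian.nontrivial_quotient [Nontrivial Z] (hB : IsSymplectic B) (Y : Lagrangian B) :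
    Nontrivial (Z ⧸ Y.space) := by
  refine Submodule.Quotient.nontrivial_iff.2 fun hY => ?_
  obtain ⟨z, hz⟩ := exists_ne (0 : Z)
  refine hz (hB.nondegenerate.2 z fun w => Y.isotropic ?_ ?_) <;> rw [hY] <;> trivial

end Main

end Oscillator

/-! ### Conclusion, with the degenerate cases. -/

open Oscillator in
theorem lemma3p3 {F : Type*} [NontriviallyNormedField F] [LocallyCompactSpace F] [CharZero F]
    (ψ : AddChar F Circle) (hψ : Continuous ψ) (hψ1 : ψ ≠ 1)
    {Z : Type*} [AddCommGroup Z] [Module F Z] [TopologicalSpace Z] [IsTopologicalAddGroup Z]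
    [ContinuousSMul F Z] [T2Space Z] [FiniteDimensional F Z] [MeasurableSpace Z] [BorelSpace Z]
    (B : LinearMap.BilinForm F Z) (hB : Oscillator.IsSymplectic B)
    -- the self-dual Haar measure on `Z`
    (dz : Oscillator.HaarMeasure Z) (hdz : Oscillator.IsSelfDual ψ B dz)
    (Y : Oscillator.Lagrangian B)
    -- the self-dual Haar measure that enters the canonical intertwiner from `Y ⊕ Y` to the diagonal
    (μ : Oscillator.HaarMeasure
      (Oscillator.SubQuot Y.double.space (Oscillator.diagonal hB).space))
    (hμ : Oscillator.IsSelfDual ψ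
      (Oscillator.subQuotForm Y.double (Oscillator.diagonal hB)) μ)
    (X : Submodule F Z) (hX : IsCompl Y.space X) (dx : Oscillator.HaarMeasure (Z ⧸ Y.space))
    (φ₁ φ₂ : Oscillator.HalfDensity ψ B Y.space) (h₁ : φ₁.IsSmooth) (h₂ : φ₂.IsSmooth) :
    Oscillator.IsSchwartzBruhat
        (Oscillator.diagonalModel hB dz
          (Oscillator.toDiagonal hB Y μ (Oscillator.doubling hB.isAlt Y hX dx φ₁ φ₂))) ∧
      Oscillator.diagonalModel hB dz
          (Oscillator.toDiagonal hB Y μ (Oscillator.doubling hB.isAlt Y hX dx φ₁ φ₂)) 0 =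
        φ₁.inner φ₂ := by
  obtain ⟨X', h, hX'⟩ := Y.exists_isCompl_isotropic hB
  obtain ⟨K, hK, hΦ⟩ := exists_diagonalModel_eq_integral hB dz Y μ hX dx φ₁ φ₂ h hX'
  have h0 : diagonalModel hB dz (toDiagonal hB Y μ (doubling hB.isAlt Y hX dx φ₁ φ₂)) 0 =
      K * φ₁.inner φ₂ := by
    rw [← map_zero (firstCopyEquiv hB), hΦ, HalfDensity.inner_eq_integral Y h dx]
    simp [toFunction]
  rw [h0]
  have hZ := borelSpace_prod F Z
  -- On `Z = 0` the constant function `1` is the test function that gives `K = 1`.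
  rcases subsingleton_or_nontrivial Z with hZ' | hZ'
  · have : Subsingleton ((Z × Z) ⧸ (diagonal hB).space) :=
      (firstCopyEquiv hB).symm.injective.subsingleton
    refine ⟨isSchwartzBruhat_of_subsingleton _, ?_⟩
    rw [hK ⟨1, 0, isSchwartzBruhat_of_subsingleton _, one_ne_zero⟩ hdz hμ, one_mul]
  -- If `φ₁ = 0`, both sides vanish whatever `K` is, and nothing about `F` is needed.
  by_cases hφ : ∀ q, toFunction h dx φ₁ q = 0
  · constructor
    · refine Or.inl ?_
      have hz : diagonalModel hB dz (toDiagonal hB Y μ (doubling hB.isAlt Y hX dx φ₁ φ₂)) = 0 := by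
        funext q
        obtain ⟨z, rfl⟩ := (firstCopyEquiv hB).surjective q
        rw [hΦ]
        simp [φ₁.coeff_eq_splitting hB.isAlt Y h, hφ]
      rw [hz]
      exact ⟨IsLocallyConstant.const 0, HasCompactSupport.zero⟩
    · rw [HalfDensity.inner_eq_integral Y h dx]
      simp [hφ]
  -- The non-zero `φ₁` is also non-zero in the coordinates in which it is known to be
  -- Schwartz–Bruhat, and so reveals the type of `F`.
  · have hF : HasCompactOpenNhd F ∨ IsRealGroup F := by
      have := Y.nontrivial_quotient hB
      obtain ⟨X'', h'', d'', hsb⟩ := h₁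
      by_cases hzero : ∀ q, toFunction h'' d'' φ₁ q = 0
      · refine absurd (fun q => ?_) hφ
        change φ₁.coeff dx (splitting h q) = 0
        rw [φ₁.coeff_smul _ dx d'' (HaarMeasure.eq_ratio_smul F d'' dx),
          φ₁.coeff_eq_splitting hB.isAlt Y h'', hzero, mul_zero, mul_zero]
      · push Not at hzero
        obtain ⟨q, hq⟩ := hzero
        exact hsb.fieldType F hq
    have hK1 := hK (exists_isSchwartzBruhat_ne_zero hF) hdz hμ
    rw [hK1, one_mul]
    refine ⟨?_, rfl⟩
    have hsb := (isSchwartzBruhat_integral_translate hF hψ hψ1 hB Y h hX' dx h₁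
      h₂).comp_linearEquiv (firstCopyEquiv hB).symm
    convert hsb using 2 with q
    obtain ⟨z, rfl⟩ := (firstCopyEquiv hB).surjective q
    rw [hΦ, hK1, one_mul, LinearEquiv.symm_apply_apply]
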